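/- Let $k$ be a commutative ring, and let all algebras be associative unital $k$-algebras. **Definitions.** A *coring* over an algebra $R$ is an $(R,R)$-bimodule $C$ with bimodule maps $\Delta:C\to C\otimes_RC$, $c\mapsto c^{(1)}\otimes_R c^{(2)}$, and $\epsilon:C\to R$ that are coassociative and counital. A *bialgebroid* $(H,R,\alpha,\beta,\Delta,\epsilon)$ consists of algebras $H,R$, an algebra homomorphism $\alpha:R\to H$ and an algebra antihomomorphism $\beta:R\to H$ with $\alpha(a)\beta(b)=\beta(b)\alpha(a)$ for all $a,b\in R$, and a coring structure $(\Delta,\epsilon)$ over $R$ on $H$ with the bimodule structure $axb=\alpha(a)\beta(b)x$, such that $\Delta(h)(\beta(r)\otimes1-1\otimes\alpha(r))=0$ in $H\otimes_RH$, $\Delta(gh)=\Delta(g)\Delta(h)$ and $\epsilon(1)=1$. A *para Hopf algebroid* is a bialgebroid with an algebra antihomomorphism $T:H\to H$ such that $T\beta=\alpha$, $T^2=\mathrm{id}$, and for all $h\in H$ $$T(h^{(1)})h^{(2)}=\beta(\epsilon(T(h))),\qquad T(h^{(1)})^{(1)}h^{(2)}\otimes_R T(h^{(1)})^{(2)}=1\otimes_R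 T(h). \tag{1}$$ Then $H$ acts on $R$ by $h\cdot r=\epsilon(h\alpha(r))$ and diagonally on tensor products over $R$ of $H$-modules (with $R$ acting from the left through $\alpha$ and from the right through $\beta$). An *$H$-module coring* is a coring $C$ over $R$ with a left $H$-module structure whose left and right $R$-actions are those induced by $\alpha$ and $\beta$, and such that $\Delta:C\to C\otimes_RC$ and $\epsilon:C\to R$ are $H$-linear. **Theorem 3.1.** Let $(H,R)$ be a para Hopf algebroid and $C$ an $H$-module coring over $R$. Regard $C$ as a right $H$-module by $c\cdot h=T(h)c$ and $C^{\otimes_Rn}$ (with $C^{\otimes_R0}=R$) as a left $H$-module by the actions above, and put $C^n=C\otimes_HC^{\otimes_Rn}$ for $n\ge0$. Then there are unique well-defined $k$-linear maps $\delta_i:C^n\to C^{n+1}$ $(0\le i\le n+1)$, $\sigma_j:C^{n}\to C^{n-1}$ $(n\ge 1,\ 0\le j\le n-1)$ and $\tau:C^n\to C^n$ such that in degree $0$ $$\delta_0(c\otimes_Hr)=c^{(1)}\otimes_H\beta(r)c^{(2)},\qquad \delta_1(c\otimes_Hr)=c^{(2)}\otimes_H\alpha(r)c^{(1)},\qquad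 \tau=\mathrm{id},$$ and for $n\ge1$ $$\delta_i(c_0\otimes_Hc_1\otimes_R\cdots\otimes_Rc_n)=c_0\otimes_H\cdots\otimes_R\Delta(c_i)\otimes_R\cdots\otimes_Rc_n\quad(0\le i\le n)$$ (for $i=0$ this means $c_0^{(1)}\otimes_H c_0^{(2)}\otimes_R c_1\otimes_R\cdots\otimes_R c_n$), $$\delta_{n+1}(c_0\otimes_Hc_1\otimes_R\cdots\otimes_Rc_n)=c_0^{(2)}\otimes_Hc_1\otimes_R\cdots\otimes_Rc_n\otimes_Rc_0^{(1)},$$ $$\sigma_j(c_0\otimes_Hc_1\otimes_R\cdots\otimes_Rc_n)=c_0\otimes_H\cdots\otimes_R\epsilon(c_{j+1})\otimes_R\cdots\otimes_Rc_n\quad(0\le j\le n-1)$$ (for $n=1$ this is $c_0\otimes_H\epsilon(c_1)$ with $\epsilon(c_1)\in R$; for $n\ge2$ the element $\epsilon(c_{j+1})\in R$ acts on the adjacent factor on its right or on its left among $c_1,\dots,c_n$), $$\tau(c_0\otimes_Hc_1\otimes_R\cdots\otimes_Rc_n)=c_1\otimes_Hc_2\otimes_R\cdots\otimes_Rc_n\otimes_Rc_0,$$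 and these maps make $(C^n)_{n\ge0}$ a cocyclic $k$-module, that is, they satisfy $$\delta_i\delta_j=\delta_j\delta_{i-1}\ (j<i),\qquad \sigma_i\sigma_j=\sigma_j\sigma_{i+1}\ (j\le i),$$ $$\sigma_j\delta_i=\delta_i\sigma_{j-1}\ (i<j),\qquad \sigma_j\delta_i=\mathrm{id}\ (i=j,\,j+1),\qquad \sigma_j\delta_i=\delta_{i-1}\sigma_j\ (i>j+1),$$ and, on $C^n$ for every $n\ge0$, $$\tau\delta_i=\delta_{i-1}\tau\ (1\le i\le n+1),\qquad \tau\delta_0=\delta_{n+1},\qquad \tau^{n+1}=\mathrm{id},$$ and, on $C^n$ for every $n\ge1$, $$\tau\sigma_j=\sigma_{j-1}\tau\ (1\le j\le n-1),\qquad \tau\sigma_0=\sigma_{n-1}\tau^2.$$ -/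

import Mathlib

open scoped TensorProduct
open MulOpposite (op)

universe u v w

/-! ## Balanced tensor products -/

/-- Let `M` be a `k`-module on which the elements of `A` act from the right through `ρ`, and `N` a
`k`-module on which they act from the left through `lam`. This is `M ⊗_A N`, the quotient of
`M ⊗[k] N` by the relations `m·a ⊗ n = m ⊗ a·n`. -/
def BalancedTensor {k A M N : Type*} [CommRing k] [AddCommGroup M] [Module k M]
    [AddCommGroup N] [Module k N] (ρ : A → Module.End k M) (lam : A → Module.End k N) : Type _ :=
  (M ⊗[k] N) ⧸ Submodule.span k
    {x : M ⊗[k] N | ∃ (a : A) (m : M) (n : N), x = ρ a m ⊗ₜ[k] n - m ⊗ₜ[k] lam a n}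

namespace BalancedTensor

section

variable {k A M N : Type*} [CommRing k] [AddCommGroup M] [Module k M]
  [AddCommGroup N] [Module k N] (ρ : A → Module.End k M) (lam : A → Module.End k N)

instance : AddCommGroup (BalancedTensor ρ lam) := Submodule.Quotient.addCommGroup _

instance : Module k (BalancedTensor ρ lam) := Submodule.Quotient.module _

/-- The projection `M ⊗[k] N → M ⊗_A N`. -/
def proj : M ⊗[k] N →ₗ[k] BalancedTensor ρ lam := Submodule.mkQ _

/-- The elementary tensor `m ⊗_A n`. -/
def tmul (m : M) (n : N) : BalancedTensor ρ lam := proj ρ lam (m ⊗ₜ[k] n)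

end

variable {k A M N Q : Type*} [CommRing k] [AddCommGroup M] [Module k M]
  [AddCommGroup N] [Module k N] [AddCommGroup Q] [Module k Q]
  (ρ : A → Module.End k M) (lam : A → Module.End k N)

@[simp] theorem proj_tmul (m : M) (n : N) : proj ρ lam (m ⊗ₜ n) = tmul ρ lam m n := rfl

theorem tmul_balance (a : A) (m : M) (n : N) :
    tmul ρ lam (ρ a m) n = tmul ρ lam m (lam a n) :=
  (Submodule.Quotient.eq _).2 (Submodule.subset_span ⟨a, m, n, rfl⟩)

/-- The universal property: a `k`-linear map out of `M ⊗[k] N` which is balanced over `A`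
descends to `M ⊗_A N`. -/
def lift (f : M ⊗[k] N →ₗ[k] Q)
    (hf : ∀ a m n, f (ρ a m ⊗ₜ n) = f (m ⊗ₜ lam a n)) : BalancedTensor ρ lam →ₗ[k] Q :=
  Submodule.liftQ _ f (Submodule.span_le.2 (by
    rintro _ ⟨a, m, n, rfl⟩
    simp [hf]))

@[simp] theorem lift_tmul (f : M ⊗[k] N →ₗ[k] Q)
    (hf : ∀ a m n, f (ρ a m ⊗ₜ n) = f (m ⊗ₜ lam a n)) (m : M) (n : N) :
    lift ρ lam f hf (tmul ρ lam m n) = f (m ⊗ₜ n) := rfl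

/-- The bilinear map `(m, n) ↦ m ⊗_A n`. -/
def mk : M →ₗ[k] N →ₗ[k] BalancedTensor ρ lam :=
  (TensorProduct.mk k M N).compr₂ (proj ρ lam)

@[simp] theorem mk_apply (m : M) (n : N) : mk ρ lam m n = tmul ρ lam m n := rfl

theorem exists_sum (x : BalancedTensor ρ lam) :
    ∃ (p : ℕ) (a : Fin p → M) (b : Fin p → N), x = ∑ i, tmul ρ lam (a i) (b i) := by
  obtain ⟨y, rfl⟩ : ∃ y, proj ρ lam y = x := Submodule.Quotient.mk_surjective _ x
  induction y with
  | zero => exact ⟨0, Fin.elim0, Fin.elim0, by simp⟩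
  | tmul m n => exact ⟨1, fun _ => m, fun _ => n, by simp⟩
  | add y z hy hz =>
    obtain ⟨p, a, b, h⟩ := hy
    obtain ⟨q, a', b', h'⟩ := hz
    refine ⟨p + q, Fin.append a a', Fin.append b b', ?_⟩
    rw [map_add, h, h', Fin.sum_univ_add]
    simp

theorem ext {f g : BalancedTensor ρ lam →ₗ[k] Q}
    (h : ∀ m n, f (tmul ρ lam m n) = g (tmul ρ lam m n)) : f = g := by
  refine LinearMap.ext fun x => ?_
  obtain ⟨p, a, b, rfl⟩ := exists_sum ρ lam x
  simp [h]

end BalancedTensor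

/-! ## Bimodules over a noncommutative algebra, and corings -/

/-- An `(R, R)`-bimodule structure on the `k`-module `M`: commuting left and right actions of the
`k`-algebra `R` by `k`-linear maps. -/
structure RBimodule (k R M : Type*) [CommRing k] [Ring R] [Algebra k R] [AddCommGroup M]
    [Module k M] where
  /-- the left action, `left a m = a m` -/
  left : R →ₐ[k] Module.End k M
  /-- the right action, `right (op a) m = m a` -/
  right : Rᵐᵒᵖ →ₐ[k] Module.End k M
  comm : ∀ (a b : R) (m : M), left a (right (op b) m) = right (op b) (left a m)

namespace RBimodule

variable {k R M N L : Type*} [CommRing k] [Ring R] [Algebra k R] [AddCommGroup M] [Module k M]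
  [AddCommGroup N] [Module k N] [AddCommGroup L] [Module k L]

/-- `M ⊗_R N` for `(R, R)`-bimodules `M` and `N`. -/
abbrev Tensor (P : RBimodule k R M) (Q : RBimodule k R N) : Type _ :=
  BalancedTensor (fun a : R => P.right (op a)) (fun a : R => Q.left a)

/-- The elementary tensor `m ⊗_R n`. -/
abbrev tmul (P : RBimodule k R M) (Q : RBimodule k R N) (m : M) (n : N) : P.Tensor Q :=
  BalancedTensor.tmul (fun a : R => P.right (op a)) (fun a : R => Q.left a) m n

/-- `f ⊗_R id` for `f` commuting with the right action of `R`. -/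
def mapLeft (P : RBimodule k R M) (Q : RBimodule k R N) (f : Module.End k M)
    (hf : ∀ a m, f (P.right (op a) m) = P.right (op a) (f m)) : Module.End k (P.Tensor Q) :=
  BalancedTensor.lift _ _ ((BalancedTensor.proj _ _).comp (f.rTensor N)) (fun a m n => by
    simpa [hf] using BalancedTensor.tmul_balance
      (fun a : R => P.right (op a)) (fun a : R => Q.left a) a (f m) n)

/-- `id ⊗_R g` for `g` commuting with the left action of `R`. -/
def mapRight (P : RBimodule k R M) (Q : RBimodule k R N) (g : Module.End k N)
    (hg : ∀ a n, g (Q.left a n) = Q.left a (g n)) : Module.End k (P.Tensor Q) :=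
  BalancedTensor.lift _ _ ((BalancedTensor.proj _ _).comp (g.lTensor M)) (fun a m n => by
    simpa [hg] using BalancedTensor.tmul_balance
      (fun a : R => P.right (op a)) (fun a : R => Q.left a) a m (g n))

@[simp] theorem mapLeft_tmul (P : RBimodule k R M) (Q : RBimodule k R N) (f : Module.End k M)
    (hf : ∀ a m, f (P.right (op a) m) = P.right (op a) (f m)) (m : M) (n : N) :
    P.mapLeft Q f hf (P.tmul Q m n) = P.tmul Q (f m) n := rfl

@[simp] theorem mapRight_tmul (P : RBimodule k R M) (Q : RBimodule k R N) (g : Module.End k N)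
    (hg : ∀ a n, g (Q.left a n) = Q.left a (g n)) (m : M) (n : N) :
    P.mapRight Q g hg (P.tmul Q m n) = P.tmul Q m (g n) := rfl

/-- The left action `a (m ⊗ n) = a m ⊗ n` on `M ⊗_R N`. -/
def tensorLeft (P : RBimodule k R M) (Q : RBimodule k R N) : R →ₐ[k] Module.End k (P.Tensor Q) :=
  AlgHom.ofLinearMap
    { toFun := fun a => P.mapLeft Q (P.left a) (fun b m => P.comm a b m)
      map_add' := fun a b => BalancedTensor.ext _ _ fun m n => by
        simp only [LinearMap.add_apply, mapLeft_tmul, map_add]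
        simp only [← BalancedTensor.mk_apply, map_add, LinearMap.add_apply]
      map_smul' := fun c a => BalancedTensor.ext _ _ fun m n => by
        simp only [LinearMap.smul_apply, mapLeft_tmul, map_smul, RingHom.id_apply]
        simp only [← BalancedTensor.mk_apply, map_smul, LinearMap.smul_apply] }
    (BalancedTensor.ext _ _ fun m n => by simp)
    (fun a b => BalancedTensor.ext _ _ fun m n => by simp)

/-- The right action `(m ⊗ n) a = m ⊗ n a` on `M ⊗_R N`. -/
def tensorRight (P : RBimodule k R M) (Q : RBimodule k R N) :
    Rᵐᵒᵖ →ₐ[k] Module.End k (P.Tensor Q) :=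
  AlgHom.ofLinearMap
    { toFun := fun a => P.mapRight Q (Q.right a) (fun b n => by simpa using (Q.comm b a.unop n).symm)
      map_add' := fun a b => BalancedTensor.ext _ _ fun m n => by
        change P.tmul Q m (Q.right (a + b) n) = P.tmul Q m (Q.right a n) + P.tmul Q m (Q.right b n)
        simp only [← BalancedTensor.mk_apply, map_add, LinearMap.add_apply]
      map_smul' := fun c a => BalancedTensor.ext _ _ fun m n => by
        change P.tmul Q m (Q.right (c • a) n) = c • P.tmul Q m (Q.right a n)
        simp only [← BalancedTensor.mk_apply, map_smul, LinearMap.smul_apply] }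
    (BalancedTensor.ext _ _ fun m n => by
      change P.tmul Q m (Q.right 1 n) = P.tmul Q m n
      rw [map_one, Module.End.one_apply])
    (fun a b => BalancedTensor.ext _ _ fun m n => by
      change P.tmul Q m (Q.right (a * b) n) = P.tmul Q m (Q.right a (Q.right b n))
      rw [map_mul, Module.End.mul_apply])

@[simp] theorem tensorLeft_tmul (P : RBimodule k R M) (Q : RBimodule k R N) (a : R) (m : M)
    (n : N) : P.tensorLeft Q a (P.tmul Q m n) = P.tmul Q (P.left a m) n := rfl

@[simp] theorem tensorRight_tmul (P : RBimodule k R M) (Q : RBimodule k R N) (a : Rᵐᵒᵖ) (m : M)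
    (n : N) : P.tensorRight Q a (P.tmul Q m n) = P.tmul Q m (Q.right a n) := rfl

/-- The bimodule `M ⊗_R N`, with `a (m ⊗ n) = a m ⊗ n` and `(m ⊗ n) a = m ⊗ n a`. -/
def tensor (P : RBimodule k R M) (Q : RBimodule k R N) : RBimodule k R (P.Tensor Q) where
  left := P.tensorLeft Q
  right := P.tensorRight Q
  comm := fun a b x => by
    obtain ⟨p, m, n, rfl⟩ := BalancedTensor.exists_sum _ _ x
    simp only [map_sum, tensorLeft_tmul, tensorRight_tmul]

/-- The map `(M ⊗_R N) × L → M ⊗_R (N ⊗_R L)`, `(m ⊗ n, l) ↦ m ⊗ (n ⊗ l)`, linear in the first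
variable. -/
def assoc (P : RBimodule k R M) (Q : RBimodule k R N) (S : RBimodule k R L) (l : L) :
    P.Tensor Q →ₗ[k] P.Tensor (Q.tensor S) :=
  BalancedTensor.lift _ _
    ((BalancedTensor.proj _ _).comp (LinearMap.lTensor M ((BalancedTensor.mk _ _).flip l)))
    (fun a m n => BalancedTensor.tmul_balance (fun a : R => P.right (op a))
      (fun a : R => (Q.tensor S).left a) a m (Q.tmul S n l))

theorem assoc_tmul (P : RBimodule k R M) (Q : RBimodule k R N) (S : RBimodule k R L)
    (m : M) (n : N) (l : L) :
    P.assoc Q S l (P.tmul Q m n) = P.tmul (Q.tensor S) m (Q.tmul S n l) := rfl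

end RBimodule

/-- A coring over the `k`-algebra `R` with underlying `(R, R)`-bimodule `P` on `C`. In the axioms,
`a`, `b` run over all ways `∑ i, a i ⊗_R b i` of writing the coproduct of `c`. -/
structure Coring {k R C : Type*} [CommRing k] [Ring R] [Algebra k R] [AddCommGroup C] [Module k C]
    (P : RBimodule k R C) where
  /-- the coproduct, a map of bimodules -/
  comul : C →ₗ[k] P.Tensor P
  /-- the counit, a map of bimodules -/
  counit : C →ₗ[k] R
  comul_left : ∀ a c, comul (P.left a c) = (P.tensor P).left a (comul c)
  comul_right : ∀ a c, comul (P.right (op a) c) = (P.tensor P).right (op a) (comul c)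
  counit_left : ∀ a c, counit (P.left a c) = a * counit c
  counit_right : ∀ a c, counit (P.right (op a) c) = counit c * a
  /-- `(id ⊗ Δ) Δ = (Δ ⊗ id) Δ` in `C ⊗_R C ⊗_R C` -/
  coassoc : ∀ (c : C) (ι : Type) [Fintype ι] (a b : ι → C), comul c = ∑ i, P.tmul P (a i) (b i) →
    ∑ i, P.tmul (P.tensor P) (a i) (comul (b i)) = ∑ i, P.assoc P P (b i) (comul (a i))
  /-- `(id ⊗ ε) Δ = id` -/
  comul_counit : ∀ (c : C) (ι : Type) [Fintype ι] (a b : ι → C),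
    comul c = ∑ i, P.tmul P (a i) (b i) → ∑ i, P.right (op (counit (b i))) (a i) = c
  /-- `(ε ⊗ id) Δ = id` -/
  counit_comul : ∀ (c : C) (ι : Type) [Fintype ι] (a b : ι → C),
    comul c = ∑ i, P.tmul P (a i) (b i) → ∑ i, P.left (counit (a i)) (b i) = c

/-! ## Bialgebroids -/

/-- Algebras `H` and `R` with an algebra homomorphism `α : R → H` and an algebra antihomomorphism
`β : R → H` with commuting images. -/
structure SourceTarget (k R H : Type*) [CommRing k] [Ring R] [Algebra k R] [Ring H]
    [Algebra k H] where
  α : R →ₐ[k] H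
  β : Rᵐᵒᵖ →ₐ[k] H
  α_β_comm : ∀ a b : R, α a * β (op b) = β (op b) * α a

/-- The `(R, R)`-bimodule `a m b = α(a) β(b) m` underlying a representation `act` of `H` on `M`. -/
def SourceTarget.bimodule {k R H M : Type*} [CommRing k] [Ring R] [Algebra k R] [Ring H]
    [Algebra k H] [AddCommGroup M] [Module k M] (S : SourceTarget k R H)
    (act : H →ₐ[k] Module.End k M) : RBimodule k R M where
  left := act.comp S.α
  right := act.comp S.β
  comm := fun a b m => by
    have := congrArg (fun h => act h m) (S.α_β_comm a b)
    simpa using this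

/-- The `(R, R)`-bimodule structure on `H` itself. -/
abbrev SourceTarget.regular {k R H : Type*} [CommRing k] [Ring R] [Algebra k R] [Ring H]
    [Algebra k H] (S : SourceTarget k R H) : RBimodule k R H :=
  S.bimodule (Algebra.lsmul k k H)

/-- A bialgebroid `(H, R, α, β, Δ, ε)`. The expressions in Sweedler notation are evaluated on all
ways of writing a coproduct as a finite sum of elementary tensors. -/
structure Bialgebroid (k R H : Type*) [CommRing k] [Ring R] [Algebra k R] [Ring H]
    [Algebra k H] extends SourceTarget k R H where
  /-- `(H, R, Δ, ε)` is a coring for the bimodule structure via `α` and `β` -/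
  coring : Coring toSourceTarget.regular
  /-- `Δ(h)(β(r) ⊗ 1 - 1 ⊗ α(r)) = 0` in `H ⊗_R H` -/
  comul_β_α : ∀ (h : H) (r : R) (ι : Type) [Fintype ι] (a b : ι → H),
    coring.comul h = ∑ i, toSourceTarget.regular.tmul toSourceTarget.regular (a i) (b i) →
    ∑ i, toSourceTarget.regular.tmul toSourceTarget.regular (a i * β (op r)) (b i) =
      ∑ i, toSourceTarget.regular.tmul toSourceTarget.regular (a i) (b i * α r)
  /-- `Δ(gh) = Δ(g)Δ(h)` -/
  comul_mul : ∀ (g h : H) (ι κ : Type) [Fintype ι] [Fintype κ] (a b : ι → H) (c d : κ → H),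
    coring.comul g = ∑ i, toSourceTarget.regular.tmul toSourceTarget.regular (a i) (b i) →
    coring.comul h = ∑ j, toSourceTarget.regular.tmul toSourceTarget.regular (c j) (d j) →
    coring.comul (g * h) =
      ∑ i, ∑ j, toSourceTarget.regular.tmul toSourceTarget.regular (a i * c j) (b i * d j)
  counit_one : coring.counit 1 = 1

namespace Bialgebroid

variable {k R H M N : Type*} [CommRing k] [Ring R] [Algebra k R] [Ring H]
  [Algebra k H] [AddCommGroup M] [Module k M] [AddCommGroup N] [Module k N]

/-- The elementary tensor `g ⊗_R h` in `H ⊗_R H`. -/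
abbrev tmulH (B : Bialgebroid k R H) (g h : H) : B.regular.Tensor B.regular :=
  B.regular.tmul B.regular g h

/-- `M ⊗_R N` for representations of `H` on `M` and `N`. -/
abbrev TensorM (B : Bialgebroid k R H) (ρ : H →ₐ[k] Module.End k M) (σ : H →ₐ[k] Module.End k N) :
    Type _ :=
  (B.bimodule ρ).Tensor (B.bimodule σ)

/-- The elementary tensor `m ⊗_R n` for representations of `H` on `M` and `N`. -/
abbrev tmulM (B : Bialgebroid k R H) (ρ : H →ₐ[k] Module.End k M) (σ : H →ₐ[k] Module.End k N)
    (m : M) (n : N) : B.TensorM ρ σ :=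
  (B.bimodule ρ).tmul (B.bimodule σ) m n

/-- The map `H ⊗_R H → Hom(M ⊗ N, M ⊗_R N)`, `g ⊗ h ↦ (m ⊗ n ↦ g m ⊗_R h n)`. -/
def pairing (B : Bialgebroid k R H) (ρ : H →ₐ[k] Module.End k M) (σ : H →ₐ[k] Module.End k N) :
    B.regular.Tensor B.regular →ₗ[k] (M ⊗[k] N →ₗ[k] B.TensorM ρ σ) :=
  BalancedTensor.lift _ _
    ((TensorProduct.map₂ ρ.toLinearMap σ.toLinearMap).compr₂ (BalancedTensor.proj _ _))
    (fun r g h => TensorProduct.ext' fun m n => by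
      have := BalancedTensor.tmul_balance (fun a : R => (B.bimodule ρ).right (op a))
        (fun a : R => (B.bimodule σ).left a) r (ρ g m) (σ h n)
      change B.tmulM ρ σ (ρ (B.β (op r) * g) m) (σ h n) = B.tmulM ρ σ (ρ g m) (σ (B.α r * h) n)
      rw [map_mul, map_mul]
      exact this)

theorem pairing_tmul (B : Bialgebroid k R H) (ρ : H →ₐ[k] Module.End k M)
    (σ : H →ₐ[k] Module.End k N) (g h : H) (m : M) (n : N) :
    B.pairing ρ σ (B.tmulH g h) (m ⊗ₜ n) = B.tmulM ρ σ (ρ g m) (σ h n) := rfl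

/-- The diagonal action `h·(m ⊗_R n) = h⁽¹⁾ m ⊗_R h⁽²⁾ n` of `H` on `M ⊗_R N`. -/
def diag (B : Bialgebroid k R H) (ρ : H →ₐ[k] Module.End k M) (σ : H →ₐ[k] Module.End k N) :
    H →ₗ[k] Module.End k (B.TensorM ρ σ) where
  toFun h := BalancedTensor.lift _ _ (B.pairing ρ σ (B.coring.comul h)) (fun r m n => by
    obtain ⟨p, a, b, hab⟩ := BalancedTensor.exists_sum _ _ (B.coring.comul h)
    have key := congrArg (fun w => B.pairing ρ σ w (m ⊗ₜ n))
      (B.comul_β_α h r (Fin p) a b hab)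
    simp only [map_sum, LinearMap.sum_apply] at key
    rw [hab]
    simp only [map_sum, LinearMap.sum_apply]
    simp only [pairing_tmul, map_mul] at key ⊢
    exact key)
  map_add' g h := BalancedTensor.ext _ _ fun m n => by simp
  map_smul' c h := BalancedTensor.ext _ _ fun m n => by simp

theorem diag_tmul (B : Bialgebroid k R H) (ρ : H →ₐ[k] Module.End k M)
    (σ : H →ₐ[k] Module.End k N) (h : H) {ι : Type} [Fintype ι] (a b : ι → H)
    (hab : B.coring.comul h = ∑ i, B.tmulH (a i) (b i)) (m : M) (n : N) :
    B.diag ρ σ h (B.tmulM ρ σ m n) = ∑ i, B.tmulM ρ σ (ρ (a i) m) (σ (b i) n) := by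
  change B.pairing ρ σ (B.coring.comul h) (m ⊗ₜ n) = _
  rw [hab]
  simp only [map_sum, LinearMap.sum_apply]
  rfl

theorem diag_mul (B : Bialgebroid k R H) (ρ : H →ₐ[k] Module.End k M)
    (σ : H →ₐ[k] Module.End k N) (g h : H) :
    B.diag ρ σ (g * h) = B.diag ρ σ g * B.diag ρ σ h := by
  refine BalancedTensor.ext _ _ fun m n => ?_
  obtain ⟨p, a, b, hab⟩ := BalancedTensor.exists_sum _ _ (B.coring.comul g)
  obtain ⟨q, c, d, hcd⟩ := BalancedTensor.exists_sum _ _ (B.coring.comul h)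
  have hgh := B.comul_mul g h (Fin p) (Fin q) a b c d hab hcd
  rw [← Fintype.sum_prod_type'
    (f := fun i j => B.tmulH (a i * c j) (b i * d j))] at hgh
  rw [Module.End.mul_apply]
  erw [B.diag_tmul ρ σ (g * h) _ _ hgh m n, B.diag_tmul ρ σ h c d hcd m n]
  simp only [map_sum, B.diag_tmul ρ σ g a b hab, map_mul, Module.End.mul_apply]
  rw [Fintype.sum_prod_type, Finset.sum_comm]

/-- `Δ(g) · Δ(h)` computed by the diagonal action of `H` on `H ⊗_R H`. -/
theorem diag_comul (B : Bialgebroid k R H) (g h : H) :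
    B.diag (Algebra.lsmul k k H) (Algebra.lsmul k k H) g (B.coring.comul h)
      = B.coring.comul (g * h) := by
  obtain ⟨p, a, b, hab⟩ := BalancedTensor.exists_sum _ _ (B.coring.comul g)
  obtain ⟨q, c, d, hcd⟩ := BalancedTensor.exists_sum _ _ (B.coring.comul h)
  rw [B.comul_mul g h (Fin p) (Fin q) a b c d hab hcd, hcd, map_sum, Finset.sum_comm]
  refine Finset.sum_congr rfl fun j _ => ?_
  exact B.diag_tmul _ _ g a b hab (c j) (d j)

theorem counit_α (B : Bialgebroid k R H) (r : R) : B.coring.counit (B.α r) = r := by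
  have := B.coring.counit_left r 1
  simpa [SourceTarget.bimodule, B.counit_one] using this

theorem counit_β (B : Bialgebroid k R H) (r : R) : B.coring.counit (B.β (op r)) = r := by
  have := B.coring.counit_right r 1
  simpa [SourceTarget.bimodule, B.counit_one] using this

/-- The action `h·r = ε(h α(r))` of `H` on `R`. -/
def baseAct (B : Bialgebroid k R H) : H →ₗ[k] Module.End k R :=
  ((LinearMap.mul k H).compl₂ B.α.toLinearMap).compr₂ B.coring.counit

theorem baseAct_apply (B : Bialgebroid k R H) (h : H) (r : R) :
    B.baseAct h r = B.coring.counit (h * B.α r) := rfl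

end Bialgebroid

/-! ## Para Hopf algebroids -/

/-- A para Hopf algebroid: a bialgebroid with a para-antipode `T`. -/
structure ParaHopfAlgebroid (k R H : Type*) [CommRing k] [Ring R] [Algebra k R] [Ring H]
    [Algebra k H] extends Bialgebroid k R H where
  /-- the para-antipode, an algebra antihomomorphism -/
  T : H →ₗ[k] H
  T_one : T 1 = 1
  T_mul : ∀ g h, T (g * h) = T h * T g
  T_β : ∀ r : R, T (β (op r)) = α r
  /-- `T(h⁽¹⁾) h⁽²⁾ = β(ε(T(h)))` -/
  T_mul_id : ∀ (h : H) (ι : Type) [Fintype ι] (a b : ι → H),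
    coring.comul h = ∑ i, toBialgebroid.tmulH (a i) (b i) →
    ∑ i, T (a i) * b i = β (op (coring.counit (T h)))
  T_T : ∀ h, T (T h) = h
  /-- `T(h⁽¹⁾)⁽¹⁾ h⁽²⁾ ⊗_R T(h⁽¹⁾)⁽²⁾ = 1 ⊗_R T(h)` -/
  para : ∀ (h : H) (ι : Type) [Fintype ι] (a b : ι → H) (κ : ι → Type) [∀ i, Fintype (κ i)]
    (x y : ∀ i, κ i → H),
    coring.comul h = ∑ i, toBialgebroid.tmulH (a i) (b i) →
    (∀ i, coring.comul (T (a i)) = ∑ j, toBialgebroid.tmulH (x i j) (y i j)) →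
    ∑ i, ∑ j, toBialgebroid.tmulH (x i j * b i) (y i j) = toBialgebroid.tmulH 1 (T h)

namespace ParaHopfAlgebroid

variable {k R H M N : Type*} [CommRing k] [Ring R] [Algebra k R] [Ring H]
  [Algebra k H] [AddCommGroup M] [Module k M] [AddCommGroup N] [Module k N]

theorem T_α (P : ParaHopfAlgebroid k R H) (r : R) : P.T (P.α r) = P.β (op r) := by
  rw [← P.T_β, P.T_T]

/-- `Δ(1) = 1 ⊗ 1`, a consequence of the axioms. -/
theorem comul_one (P : ParaHopfAlgebroid k R H) : P.coring.comul 1 = P.tmulH 1 1 := by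
  obtain ⟨p, a, b, hab⟩ := BalancedTensor.exists_sum _ _ (P.coring.comul 1)
  have hx : ∀ i, ∃ (q : ℕ) (x y : Fin q → H),
      P.coring.comul (P.T (a i)) = ∑ j, P.tmulH (x j) (y j) :=
    fun i => BalancedTensor.exists_sum _ _ _
  choose q x y hxy using hx
  have h1 := P.para 1 (Fin p) a b (fun i => Fin (q i)) x y hab hxy
  have h2 := P.para 1 (Fin p) a b (fun i => Fin p × Fin (q i))
    (fun i s => a s.1 * x i s.2) (fun i s => b s.1 * y i s.2) hab (fun i => by
      have := P.comul_mul 1 (P.T (a i)) (Fin p) (Fin (q i)) a b (x i) (y i) hab (hxy i)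
      rw [one_mul] at this
      rw [this, Fintype.sum_prod_type])
  have h3 := congrArg (P.diag (Algebra.lsmul k k H) (Algebra.lsmul k k H) 1) h1
  have e1 : P.diag (Algebra.lsmul k k H) (Algebra.lsmul k k H) 1 (P.tmulH 1 (P.T 1))
      = P.coring.comul 1 := by
    have := P.diag_tmul (Algebra.lsmul k k H) (Algebra.lsmul k k H) 1 a b hab 1 (P.T 1)
    rw [P.T_one] at this ⊢
    refine this.trans (Eq.trans ?_ hab.symm)
    simp
  have h4 : ∀ i j, P.diag (Algebra.lsmul k k H) (Algebra.lsmul k k H) 1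
      (P.tmulH (x i j * b i) (y i j)) =
      ∑ s, P.tmulH (a s * x i j * b i) (b s * y i j) := fun i j => by
    have := P.diag_tmul (Algebra.lsmul k k H) (Algebra.lsmul k k H) 1 a b hab (x i j * b i) (y i j)
    refine this.trans ?_
    simp [mul_assoc]
  have h5 : P.coring.comul 1 = P.tmulH 1 (P.T 1) := by
    rw [← h2, ← e1, ← h1]
    simp only [map_sum, h4]
    refine Finset.sum_congr rfl fun i _ => ?_
    rw [Fintype.sum_prod_type, Finset.sum_comm]
  rw [h5, P.T_one]

/-- `T(g⁽¹⁾) β(r) g⁽²⁾ = β(ε(T(g) β(r)))`. -/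
theorem T_β_mul (P : ParaHopfAlgebroid k R H) (g : H) (r : R) {ι : Type} [Fintype ι]
    (a b : ι → H) (hab : P.coring.comul g = ∑ i, P.tmulH (a i) (b i)) :
    ∑ i, P.T (a i) * P.β (op r) * b i = P.β (op (P.coring.counit (P.T g * P.β (op r)))) := by
  have h1 : P.coring.comul (P.α r * g) = ∑ i, P.tmulH (P.α r * a i) (b i) := by
    have := P.coring.comul_left r g
    rw [hab, map_sum] at this
    exact this
  have := P.T_mul_id _ ι _ b h1
  simpa [P.T_mul, P.T_α] using this

/-- The counit satisfies `ε(gh) = ε(g β(ε(h)))`, a consequence of the axioms. -/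
theorem counit_mul (P : ParaHopfAlgebroid k R H) (g h : H) :
    P.coring.counit (g * h) = P.coring.counit (g * P.β (op (P.coring.counit h))) := by
  suffices P.β (op (P.coring.counit (g * h))) =
      P.β (op (P.coring.counit (g * P.β (op (P.coring.counit h))))) by
    simpa only [P.counit_β] using congrArg P.coring.counit this
  obtain ⟨p, a, b, hab⟩ := BalancedTensor.exists_sum _ _ (P.coring.comul (P.T g))
  obtain ⟨q, c, d, hcd⟩ := BalancedTensor.exists_sum _ _ (P.coring.comul (P.T h))
  have e1 := P.T_β_mul (P.T g) (P.coring.counit h) a b hab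
  have e2 := P.comul_mul (P.T h) (P.T g) (Fin q) (Fin p) c d a b hcd hab
  rw [← Fintype.sum_prod_type'
    (f := fun i j => P.tmulH (c i * a j) (d i * b j))] at e2
  have e3 := P.T_mul_id _ _ _ _ e2
  have e4 := P.T_mul_id _ _ _ _ hcd
  rw [P.T_T] at e1 e4
  simp only [P.T_mul, P.T_T] at e3
  rw [← e1, ← e3, ← e4, Fintype.sum_prod_type, Finset.sum_comm]
  simp only [Finset.mul_sum, Finset.sum_mul, mul_assoc]

theorem counit_mul' (P : ParaHopfAlgebroid k R H) (g h : H) :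
    P.coring.counit (g * h) = P.coring.counit (g * P.α (P.coring.counit h)) := by
  rw [P.counit_mul g h, P.counit_mul g (P.α _), P.counit_α]

/-- The diagonal action of `H` on `M ⊗_R N`, as a representation. -/
def diagHom (P : ParaHopfAlgebroid k R H) (ρ : H →ₐ[k] Module.End k M)
    (σ : H →ₐ[k] Module.End k N) : H →ₐ[k] Module.End k (P.TensorM ρ σ) :=
  AlgHom.ofLinearMap (P.diag ρ σ)
    (BalancedTensor.ext _ _ fun m n => by
      have := P.diag_tmul ρ σ 1 (fun _ : Unit => 1) (fun _ => 1) (by simpa using P.comul_one) m n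
      exact this.trans (by simp))
    (P.diag_mul ρ σ)

/-- The action `h·r = ε(h α(r))` of `H` on `R`, as a representation. -/
def baseHom (P : ParaHopfAlgebroid k R H) : H →ₐ[k] Module.End k R :=
  AlgHom.ofLinearMap P.baseAct
    (LinearMap.ext fun r => by simp [Bialgebroid.baseAct_apply, P.counit_α])
    (fun g h => LinearMap.ext fun r => by
      rw [Module.End.mul_apply, Bialgebroid.baseAct_apply, Bialgebroid.baseAct_apply,
        Bialgebroid.baseAct_apply, mul_assoc]
      exact P.counit_mul' g (h * P.α r))

end ParaHopfAlgebroid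

/-! ## Module corings -/

/-- An `H`-module coring over `R` with underlying `H`-module `C`: a coring whose left and right
actions of `R` are the ones induced by `α` and `β` from the action of `H`, and whose coproduct and
counit are `H`-linear for the diagonal action on `C ⊗_R C` and the action on `R`. -/
structure ModuleCoring {k R H : Type*} [CommRing k] [Ring R] [Algebra k R] [Ring H] [Algebra k H]
    (B : Bialgebroid k R H) (C : Type*) [AddCommGroup C] [Module k C] [Module H C]
    [IsScalarTower k H C] extends Coring (B.bimodule (Algebra.lsmul k k C)) where
  comul_smul : ∀ (h : H) (c : C), comul (h • c) =
    B.diag (Algebra.lsmul k k C) (Algebra.lsmul k k C) h (comul c)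
  counit_smul : ∀ (h : H) (c : C), counit (h • c) = B.baseAct h (counit c)

/-! ## The modules `Cⁿ = C ⊗_H C^{⊗_R n}` -/

/-- A bundled representation of the `k`-algebra `H`. -/
structure HRep (k : Type v) (H : Type w) [CommRing k] [Ring H] [Algebra k H] where
  carrier : Type u
  [addCommGroup : AddCommGroup carrier]
  [module : Module k carrier]
  act : H →ₐ[k] Module.End k carrier

attribute [instance] HRep.addCommGroup HRep.module

namespace ParaHopfAlgebroid

section

variable {k : Type v} {H : Type w} {R : Type u} [CommRing k] [Ring R] [Algebra k R] [Ring H]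
  [Algebra k H] (P : ParaHopfAlgebroid k R H)
  (C : Type u) [AddCommGroup C] [Module k C] [Module H C] [IsScalarTower k H C]

/-- The tensor power `C^{⊗_R (n+1)} = C ⊗_R (C ⊗_R ⋯)` with the diagonal action of `H`. -/
def tensorPowSucc : ℕ → HRep.{u} k H
  | 0 => { carrier := C, act := Algebra.lsmul k k C }
  | n + 1 =>
    { carrier := P.TensorM (Algebra.lsmul k k C) (tensorPowSucc n).act
      act := P.diagHom (Algebra.lsmul k k C) (tensorPowSucc n).act }

/-- The tensor power `C^{⊗_R n}` with its action of `H`, where `C^{⊗_R 0} = R`. -/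
def tensorPow : ℕ → HRep.{u} k H
  | 0 => { carrier := R, act := P.baseHom }
  | n + 1 => P.tensorPowSucc C n

/-- The element `c₀ ⊗_R c₁ ⊗_R ⋯ ⊗_R cₙ` of `C^{⊗_R (n+1)}`. -/
def powMk : (n : ℕ) → (Fin (n + 1) → C) → (P.tensorPowSucc C n).carrier
  | 0, c => c 0
  | n + 1, c =>
    P.tmulM (Algebra.lsmul k k C) (P.tensorPowSucc C n).act (c 0) (powMk n (Fin.tail c))

/-- `Cⁿ = C ⊗_H C^{⊗_R n}`, where `C` is a right `H`-module by `c·h = T(h) c`. -/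
abbrev Cochain (n : ℕ) : Type u :=
  BalancedTensor (fun h : H => Algebra.lsmul k k C (P.T h)) (fun h : H => (P.tensorPow C n).act h)

variable {C}

/-- The element `c ⊗_H r` of `C⁰ = C ⊗_H R`. -/
def zeroMk (c : C) (r : R) : P.Cochain C 0 :=
  BalancedTensor.tmul (fun h : H => Algebra.lsmul k k C (P.T h))
    (fun h : H => (P.tensorPow C 0).act h) c r

/-- The element `c₀ ⊗_H c₁ ⊗_R ⋯ ⊗_R cₙ₊₁` of `Cⁿ⁺¹`. -/
def succMk {n : ℕ} (c : Fin (n + 2) → C) : P.Cochain C (n + 1) :=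
  BalancedTensor.tmul (fun h : H => Algebra.lsmul k k C (P.T h))
    (fun h : H => (P.tensorPow C (n + 1)).act h) (c 0) (P.powMk C n (Fin.tail c))

end

end ParaHopfAlgebroid

/-! ## Cocyclic modules -/

/-- The structure of a cocyclic `k`-module on the sequence `X` of `k`-modules: cofaces
`δᵢ : Xⁿ → Xⁿ⁺¹`, codegeneracies `σⱼ : Xⁿ⁺¹ → Xⁿ` and cyclic operators `τ : Xⁿ → Xⁿ`, subject to the
cosimplicial relations and the relations of the cyclic category. -/
structure CocyclicModule (k : Type*) [CommRing k] (X : ℕ → Type*) [∀ n, AddCommGroup (X n)]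
    [∀ n, Module k (X n)] where
  δ : ∀ n, Fin (n + 2) → X n →ₗ[k] X (n + 1)
  σ : ∀ n, Fin (n + 1) → X (n + 1) →ₗ[k] X n
  τ : ∀ n, X n →ₗ[k] X n
  δ_δ : ∀ n (i j : Fin (n + 2)), i ≤ j →
    δ (n + 1) j.succ ∘ₗ δ n i = δ (n + 1) i.castSucc ∘ₗ δ n j
  σ_σ : ∀ n (i j : Fin (n + 1)), i ≤ j →
    σ n j ∘ₗ σ (n + 1) i.castSucc = σ n i ∘ₗ σ (n + 1) j.succ
  σ_δ_of_le : ∀ n (i : Fin (n + 2)) (j : Fin (n + 1)), i ≤ j.castSucc →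
    σ (n + 1) j.succ ∘ₗ δ (n + 1) i.castSucc = δ n i ∘ₗ σ n j
  σ_δ_self : ∀ n (i : Fin (n + 1)), σ n i ∘ₗ δ n i.castSucc = LinearMap.id
  σ_δ_succ : ∀ n (i : Fin (n + 1)), σ n i ∘ₗ δ n i.succ = LinearMap.id
  σ_δ_of_gt : ∀ n (i : Fin (n + 2)) (j : Fin (n + 1)), j.castSucc < i →
    σ (n + 1) j.castSucc ∘ₗ δ (n + 1) i.succ = δ n i ∘ₗ σ n j
  τ_δ_succ : ∀ n (i : Fin (n + 1)), τ (n + 1) ∘ₗ δ n i.succ = δ n i.castSucc ∘ₗ τ n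
  τ_δ_zero : ∀ n, τ (n + 1) ∘ₗ δ n 0 = δ n (Fin.last (n + 1))
  τ_σ_succ : ∀ n (i : Fin n), τ n ∘ₗ σ n i.succ = σ n i.castSucc ∘ₗ τ (n + 1)
  τ_σ_zero : ∀ n, τ n ∘ₗ σ n 0 = σ n (Fin.last n) ∘ₗ τ (n + 1) ∘ₗ τ (n + 1)
  τ_pow : ∀ n, τ n ^ (n + 1) = 1

/-! The cocyclic structure is generated by the cyclic operator `τ` and the first coface and
codegeneracy: the other maps are `δᵢ = τ⁻ⁱ δ₀ τⁱ` and `σⱼ = τ⁻ʲ σ₀ τʲ`. So only `τ`, `δ₀` and `σ₀`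
have to be shown well defined, and a cosimplicial relation, once a suitable power of `τ` is applied
to it, becomes one in which the smaller index is zero. This reduction is formal and needs only `τⁿ⁺¹
= 1` (`CocyclicModule.Generators`).

The axiom on `T(h⁽¹⁾)⁽¹⁾ h⁽²⁾ ⊗ T(h⁽¹⁾)⁽²⁾` is what makes the maps well defined. Moving `h⁽¹⁾`
across `⊗_H` turns `h⁽¹⁾c ⊗_H (h⁽²⁾m ⊗_R n)` into an instance of it, and gives `c ⊗_H (m ⊗_R T(h)n)`
(`sum_mkH_smul`). Together with the `H`-linearity of `Δ` this shows that `δ₀` is balanced over `H`;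
with the roles of the factors changed it shows the same for `τ`. For `σ₀` it suffices that
contraction with the counit is `H`-linear, a consequence of the counit axioms of `H`.

The relations are then checked on elementary tensors, where `τ` is a cyclic shift
(`rotate_cochainMk`). The substantial ones are coassociativity (`cofaceZero_cofaceZero`), the two
counit identities (`codegeneracyZero_cofaceZero`, `codegeneracyZero_coface_one`) and those
expressing the right `R`-linearity of `Δ` and `ε`; the rest involve operations on disjoint factors.
Because `Tβ = α`, the tensor sign `⊗_H` obeys the same `R`-balancing rule as the signs `⊗_R`
(`cochainMk_balance`), so rotation treats all factors alike. Uniqueness holds because elementary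
tensors span, those of the form `c ⊗_H 1` being enough in degree zero. -/

namespace BalancedTensor

variable {k A M N Q : Type*} [CommRing k] [AddCommGroup M] [Module k M]
  [AddCommGroup N] [Module k N] [AddCommGroup Q] [Module k Q]
  (ρ : A → Module.End k M) (lam : A → Module.End k N)

/-- A balanced bilinear map descends to `M ⊗_A N`. -/
def liftBilin (f : M →ₗ[k] N →ₗ[k] Q) (hf : ∀ a m n, f (ρ a m) n = f m (lam a n)) :
    BalancedTensor ρ lam →ₗ[k] Q :=
  lift ρ lam (TensorProduct.lift f) (by simpa using hf)

end BalancedTensor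

/-! ### Diagonal actions on tensor products over `R` -/

namespace ParaHopfAlgebroid

variable {k R H M N L : Type*} [CommRing k] [Ring R] [Algebra k R] [Ring H]
  [Algebra k H] [AddCommGroup M] [Module k M] [AddCommGroup N] [Module k N]
  [AddCommGroup L] [Module k L] {Q : Type*} [AddCommGroup Q] [Module k Q]
  (P : ParaHopfAlgebroid k R H)
  (ρ : H →ₐ[k] Module.End k M) (σ : H →ₐ[k] Module.End k N) (θ : H →ₐ[k] Module.End k L)

/-- The bilinear map `(m, n) ↦ m ⊗_R n`. -/
def mkM : M →ₗ[k] N →ₗ[k] P.TensorM ρ σ := BalancedTensor.mk _ _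

theorem tmulM_balance (r : R) (m : M) (n : N) :
    P.tmulM ρ σ (ρ (P.β (op r)) m) n = P.tmulM ρ σ m (σ (P.α r) n) :=
  BalancedTensor.tmul_balance (fun a : R => (P.bimodule ρ).right (op a))
    (fun a : R => (P.bimodule σ).left a) r m n

theorem mkM_balance (r : R) (m : M) (n : N) :
    P.mkM ρ σ (ρ (P.β (op r)) m) n = P.mkM ρ σ m (σ (P.α r) n) :=
  P.tmulM_balance ρ σ r m n

/-- A balanced bilinear map descends to `M ⊗_R N`. -/
def liftM (f : M →ₗ[k] N →ₗ[k] Q)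
    (hf : ∀ r m n, f (ρ (P.β (op r)) m) n = f m (σ (P.α r) n)) : P.TensorM ρ σ →ₗ[k] Q :=
  BalancedTensor.liftBilin _ _ f hf

variable {ρ σ} in
theorem tensorM_induction {p : P.TensorM ρ σ → Prop} (h0 : p 0)
    (hadd : ∀ x y, p x → p y → p (x + y)) (hmk : ∀ m n, p (P.mkM ρ σ m n)) (x : P.TensorM ρ σ) :
    p x := by
  obtain ⟨q, m, n, rfl⟩ := BalancedTensor.exists_sum _ _ x
  exact Finset.sum_induction _ p hadd h0 fun i _ => hmk _ _

theorem tensorM_ext {f g : P.TensorM ρ σ →ₗ[k] Q}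
    (h : ∀ m n, f (P.mkM ρ σ m n) = g (P.mkM ρ σ m n)) : f = g :=
  BalancedTensor.ext _ _ h

/-- Left `R`-linearity of `Δ` applied to `Δ(1) = 1 ⊗ 1`. Hence `α(r)` acts on a tensor product
through its first factor alone; `comul_β` likewise lets `β(r)` act through the last one. -/
theorem comul_α (r : R) : P.coring.comul (P.α r) = P.tmulH (P.α r) 1 := by
  have := P.coring.comul_left r 1
  rw [P.comul_one, RBimodule.tensor, RBimodule.tensorLeft_tmul] at this
  simpa [SourceTarget.bimodule] using this

theorem comul_β (r : R) : P.coring.comul (P.β (op r)) = P.tmulH 1 (P.β (op r)) := by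
  have := P.coring.comul_right r 1
  rw [P.comul_one, RBimodule.tensor, RBimodule.tensorRight_tmul] at this
  simpa [SourceTarget.bimodule] using this

theorem diagHom_mkM (h : H) {ι : Type} [Fintype ι] (a b : ι → H)
    (hab : P.coring.comul h = ∑ i, P.tmulH (a i) (b i)) (m : M) (n : N) :
    P.diagHom ρ σ h (P.mkM ρ σ m n) = ∑ i, P.mkM ρ σ (ρ (a i) m) (σ (b i) n) :=
  P.diag_tmul ρ σ h a b hab m n

theorem diagHom_mkM_eq_pairing (h : H) (m : M) (n : N) :
    P.diagHom ρ σ h (P.mkM ρ σ m n) = P.pairing ρ σ (P.coring.comul h) (m ⊗ₜ n) := rfl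

theorem pairing_tmulH (g h : H) (m : M) (n : N) :
    P.pairing ρ σ (P.tmulH g h) (m ⊗ₜ n) = P.mkM ρ σ (ρ g m) (σ h n) := rfl

theorem diagHom_α (r : R) (m : M) (n : N) :
    P.diagHom ρ σ (P.α r) (P.mkM ρ σ m n) = P.mkM ρ σ (ρ (P.α r) m) n := by
  rw [diagHom_mkM_eq_pairing, comul_α, pairing_tmulH, map_one, Module.End.one_apply]

theorem diagHom_β (r : R) (m : M) (n : N) :
    P.diagHom ρ σ (P.β (op r)) (P.mkM ρ σ m n) = P.mkM ρ σ m (σ (P.β (op r)) n) := by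
  rw [diagHom_mkM_eq_pairing, comul_β, pairing_tmulH, map_one, Module.End.one_apply]

theorem comul_mul_α (h : H) (r : R) {ι : Type} [Fintype ι] (a b : ι → H)
    (hab : P.coring.comul h = ∑ i, P.tmulH (a i) (b i)) :
    P.coring.comul (h * P.α r) = ∑ i, P.tmulH (a i * P.α r) (b i) := by
  have := P.comul_mul h (P.α r) ι Unit a b (fun _ => P.α r) (fun _ => 1) hab
    (by simpa using P.comul_α r)
  simpa using this

theorem comul_mul_β (h : H) (r : R) {ι : Type} [Fintype ι] (a b : ι → H)
    (hab : P.coring.comul h = ∑ i, P.tmulH (a i) (b i)) :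
    P.coring.comul (h * P.β (op r)) = ∑ i, P.tmulH (a i) (b i * P.β (op r)) := by
  have := P.comul_mul h (P.β (op r)) ι Unit a b (fun _ => 1) (fun _ => P.β (op r)) hab
    (by simpa using P.comul_β r)
  simpa using this

/-! ### The associativity constraint -/

/-- The trilinear map `(m, n, l) ↦ m ⊗_R (n ⊗_R l)`. -/
def mkM₃ : M →ₗ[k] N →ₗ[k] L →ₗ[k] P.TensorM ρ (P.diagHom σ θ) :=
  LinearMap.mk₂ k (fun m n => P.mkM ρ (P.diagHom σ θ) m ∘ₗ P.mkM σ θ n)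
    (fun m m' n => by rw [map_add, LinearMap.add_comp])
    (fun c m n => by rw [map_smul, LinearMap.smul_comp])
    (fun m n n' => by rw [map_add, LinearMap.comp_add])
    (fun c m n => by rw [map_smul, LinearMap.comp_smul])

theorem mkM₃_apply (m : M) (n : N) (l : L) :
    P.mkM₃ ρ σ θ m n l = P.mkM ρ (P.diagHom σ θ) m (P.mkM σ θ n l) := rfl

/-- The map `M ⊗_R N → Hom(L, M ⊗_R (N ⊗_R L))`. -/
def assocAux : P.TensorM ρ σ →ₗ[k] L →ₗ[k] P.TensorM ρ (P.diagHom σ θ) :=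
  P.liftM ρ σ (P.mkM₃ ρ σ θ) (fun r m n => LinearMap.ext fun l => by
    rw [mkM₃_apply, mkM₃_apply, mkM_balance, diagHom_α])

theorem assocAux_mkM (m : M) (n : N) (l : L) :
    P.assocAux ρ σ θ (P.mkM ρ σ m n) l = P.mkM ρ (P.diagHom σ θ) m (P.mkM σ θ n l) := rfl

/-- The associativity constraint `(M ⊗_R N) ⊗_R L → M ⊗_R (N ⊗_R L)`. -/
def assocMap : P.TensorM (P.diagHom ρ σ) θ →ₗ[k] P.TensorM ρ (P.diagHom σ θ) :=
  P.liftM (P.diagHom ρ σ) θ (P.assocAux ρ σ θ) (fun r x l => by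
    induction x using P.tensorM_induction with
    | h0 => simp only [map_zero, LinearMap.zero_apply]
    | hadd x y hx hy => simp only [map_add, LinearMap.add_apply, hx, hy]
    | hmk m n => rw [diagHom_β, assocAux_mkM, assocAux_mkM, mkM_balance])

theorem assocMap_mkM (m : M) (n : N) (l : L) :
    P.assocMap ρ σ θ (P.mkM (P.diagHom ρ σ) θ (P.mkM ρ σ m n) l) =
      P.mkM ρ (P.diagHom σ θ) m (P.mkM σ θ n l) := rfl

/-- The map `w ↦ w (n ⊗ l)` from `H ⊗_R H` to `N ⊗_R L`. -/
def pairingAt (n : N) (l : L) : P.regular.Tensor P.regular →ₗ[k] P.TensorM σ θ :=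
  (P.pairing σ θ).flip (n ⊗ₜ l)

/-- The compatibility that makes `pairingAt₃` balanced over `R`. -/
theorem pairingAt_left (n : N) (l : L) (r : R) (w : P.regular.Tensor P.regular) :
    P.pairingAt σ θ n l ((P.regular.tensor P.regular).left r w) =
      P.diagHom σ θ (P.α r) (P.pairingAt σ θ n l w) := by
  obtain ⟨p, x, y, rfl⟩ := BalancedTensor.exists_sum _ _ w
  simp only [map_sum]
  refine Finset.sum_congr rfl fun i _ => ?_
  refine Eq.trans ?_ (P.diagHom_α σ θ r (σ (x i) n) (θ (y i) l)).symm
  change P.mkM σ θ (σ (P.α r * x i) n) _ = _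
  rw [map_mul]
  rfl

/-- The map `H ⊗_R (H ⊗_R H) → M ⊗_R (N ⊗_R L)`, `g ⊗ w ↦ g m ⊗ w (n ⊗ l)`. -/
def pairingAt₃ (m : M) (n : N) (l : L) :
    P.regular.Tensor (P.regular.tensor P.regular) →ₗ[k] P.TensorM ρ (P.diagHom σ θ) :=
  BalancedTensor.liftBilin _ _
    ((P.mkM ρ (P.diagHom σ θ)).compl₁₂ (ρ.toLinearMap.flip m) (P.pairingAt σ θ n l))
    (fun r g w => by
      rw [LinearMap.compl₁₂_apply, LinearMap.compl₁₂_apply, pairingAt_left, ← mkM_balance]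
      change P.mkM ρ (P.diagHom σ θ) (ρ (P.β (op r) * g) m) _ = _
      rw [map_mul]
      rfl)

theorem assocAux_pairingAt (m : M) (n : N) (l : L) (h : H) (w : P.regular.Tensor P.regular) :
    P.assocAux ρ σ θ (P.pairingAt ρ σ m n w) (θ h l) =
      P.pairingAt₃ ρ σ θ m n l (P.regular.assoc P.regular P.regular h w) := by
  obtain ⟨p, x, y, rfl⟩ := BalancedTensor.exists_sum _ _ w
  simp only [map_sum, LinearMap.sum_apply]
  rfl

/-- Coassociativity of `H`, evaluated on `m`, `n`, `l` by `pairingAt₃`: the two iterated coproducts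
of `h` give the two bracketings of the diagonal action. -/
theorem assocMap_diagHom (h : H) (x : P.TensorM (P.diagHom ρ σ) θ) :
    P.assocMap ρ σ θ (P.diagHom (P.diagHom ρ σ) θ h x) =
      P.diagHom ρ (P.diagHom σ θ) h (P.assocMap ρ σ θ x) := by
  obtain ⟨p, a, b, hab⟩ := BalancedTensor.exists_sum _ _ (P.coring.comul h)
  induction x using P.tensorM_induction with
  | h0 => simp only [map_zero]
  | hadd x y hx hy => simp only [map_add, hx, hy]
  | hmk z l =>
    induction z using P.tensorM_induction with
    | h0 => simp only [map_zero, LinearMap.zero_apply]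
    | hadd x y hx hy => simp only [map_add, LinearMap.add_apply, hx, hy]
    | hmk m n =>
      have key := congrArg (P.pairingAt₃ ρ σ θ m n l) (P.coring.coassoc h (Fin p) a b hab)
      rw [map_sum, map_sum] at key
      rw [P.diagHom_mkM (P.diagHom ρ σ) θ h a b hab, assocMap_mkM,
        P.diagHom_mkM ρ (P.diagHom σ θ) h a b hab, map_sum]
      refine Eq.trans (Finset.sum_congr rfl fun i _ => ?_) key.symm
      exact P.assocAux_pairingAt ρ σ θ m n l (b i) (P.coring.comul (a i))

/-- `id ⊗_R f` for an `H`-linear map `f`. -/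
def mapM (f : N →ₗ[k] L) (hf : ∀ h n, f (σ h n) = θ h (f n)) :
    P.TensorM ρ σ →ₗ[k] P.TensorM ρ θ :=
  P.liftM ρ σ ((P.mkM ρ θ).compl₂ f) (fun r m n => by
    rw [LinearMap.compl₂_apply, LinearMap.compl₂_apply, hf, mkM_balance])

theorem mapM_mkM (f : N →ₗ[k] L) (hf : ∀ h n, f (σ h n) = θ h (f n)) (m : M) (n : N) :
    P.mapM ρ σ θ f hf (P.mkM ρ σ m n) = P.mkM ρ θ m (f n) := rfl

theorem mapM_diagHom (f : N →ₗ[k] L) (hf : ∀ h n, f (σ h n) = θ h (f n)) (h : H)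
    (x : P.TensorM ρ σ) :
    P.mapM ρ σ θ f hf (P.diagHom ρ σ h x) = P.diagHom ρ θ h (P.mapM ρ σ θ f hf x) := by
  obtain ⟨p, a, b, hab⟩ := BalancedTensor.exists_sum _ _ (P.coring.comul h)
  induction x using P.tensorM_induction with
  | h0 => simp only [map_zero]
  | hadd x y hx hy => simp only [map_add, hx, hy]
  | hmk m n =>
    simp only [P.diagHom_mkM ρ σ h a b hab, mapM_mkM, P.diagHom_mkM ρ θ h a b hab, map_sum, hf]

end ParaHopfAlgebroid

namespace ParaHopfAlgebroid

variable {k R H M N L : Type*} [CommRing k] [Ring R] [Algebra k R] [Ring H]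
  [Algebra k H] [AddCommGroup M] [Module k M] [AddCommGroup N] [Module k N]
  {Q : Type*} [AddCommGroup Q] [Module k Q]
  (P : ParaHopfAlgebroid k R H)
  {C : Type*} [AddCommGroup C] [Module k C] [Module H C] [IsScalarTower k H C]

/-! ### Contractions with the counit -/

section Contraction

variable (K : ModuleCoring P.toBialgebroid C) (ρ : H →ₐ[k] Module.End k M)

theorem counit_β_smul (r : R) (c : C) : K.counit (P.β (op r) • c) = K.counit c * r :=
  K.counit_right r c

theorem counit_smul (h : H) (c : C) :
    K.counit (h • c) = P.coring.counit (h * P.α (K.counit c)) :=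
  K.counit_smul h c

theorem baseHom_apply (h : H) (r : R) : P.baseHom h r = P.coring.counit (h * P.α r) := rfl

/-- The value `ε(hg)` depends on `g` only through `ε(g)`, and `α(r)`, `β(r)` both have counit `r`.
-/
theorem counit_mul_α (h : H) (r : R) :
    P.coring.counit (h * P.α r) = P.coring.counit (h * P.β (op r)) := by
  rw [P.counit_mul, P.counit_α]

/-- The map `C ⊗_R M → M`, `c ⊗ m ↦ ε(c) m`. -/
def contractLeft : P.TensorM (Algebra.lsmul k k C) ρ →ₗ[k] M :=
  P.liftM _ ρ (ρ.toLinearMap ∘ₗ P.α.toLinearMap ∘ₗ K.counit) (fun r c m => by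
    change ρ (P.α (K.counit (P.β (op r) • c))) m = ρ (P.α (K.counit c)) (ρ (P.α r) m)
    rw [counit_β_smul, map_mul, map_mul, Module.End.mul_apply])

theorem contractLeft_mkM (c : C) (m : M) :
    P.contractLeft K ρ (P.mkM (Algebra.lsmul k k C) ρ c m) = ρ (P.α (K.counit c)) m := rfl

theorem contractLeft_diagHom (h : H) (x : P.TensorM (Algebra.lsmul k k C) ρ) :
    P.contractLeft K ρ (P.diagHom _ ρ h x) = ρ h (P.contractLeft K ρ x) := by
  obtain ⟨p, a, b, hab⟩ := BalancedTensor.exists_sum _ _ (P.coring.comul h)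
  induction x using P.tensorM_induction with
  | h0 => simp only [map_zero]
  | hadd x y hx hy => simp only [map_add, hx, hy]
  | hmk c m =>
    -- The counit axiom is applied to `h α(ε(c))` instead of `h`: its coproduct has first factors
    -- `aᵢ α(ε(c))`, whose counits are the `ε(aᵢ c)`.
    have key := P.coring.counit_comul _ (Fin p) _ b (P.comul_mul_α h (K.counit c) a b hab)
    have key' := congrArg (fun g => ρ g m) key
    simp only [map_sum, LinearMap.sum_apply, map_mul, Module.End.mul_apply] at key'
    rw [P.diagHom_mkM _ ρ h a b hab, map_sum, contractLeft_mkM, ← key']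
    refine Finset.sum_congr rfl fun i _ => ?_
    rw [contractLeft_mkM]
    change ρ (P.α (K.counit (a i • c))) _ = ρ (P.α (P.coring.counit (a i * P.α (K.counit c))) * b i) m
    rw [counit_smul, map_mul ρ, Module.End.mul_apply]

/-- The map `C ⊗_R R → C`, `c ⊗ r ↦ c r`. -/
def contractBase : P.TensorM (Algebra.lsmul k k C) P.baseHom →ₗ[k] C :=
  P.liftM _ _ ((Algebra.lsmul k k C).toLinearMap ∘ₗ P.β.toLinearMap ∘ₗ
      (MulOpposite.opLinearEquiv k).toLinearMap).flip (fun r c s => by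
    change P.β (op s) • P.β (op r) • c = P.β (op (P.coring.counit (P.α r * P.α s))) • c
    rw [← map_mul, P.counit_α, MulOpposite.op_mul, map_mul, mul_smul])

theorem contractBase_mkM (c : C) (r : R) :
    P.contractBase (P.mkM (Algebra.lsmul k k C) P.baseHom c r) = P.β (op r) • c := rfl

theorem contractBase_diagHom (h : H) (x : P.TensorM (Algebra.lsmul k k C) P.baseHom) :
    P.contractBase (P.diagHom _ P.baseHom h x) = h • P.contractBase x := by
  obtain ⟨p, a, b, hab⟩ := BalancedTensor.exists_sum _ _ (P.coring.comul h)
  induction x using P.tensorM_induction with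
  | h0 => simp only [map_zero, smul_zero]
  | hadd x y hx hy => simp only [map_add, smul_add, hx, hy]
  | hmk c r =>
    -- The other counit axiom, applied to `h β(r)`, whose coproduct has second factors `bᵢ β(r)`;
    -- the action on `R` involves `bᵢ α(r)`, which has the same counit.
    have key := P.coring.comul_counit _ (Fin p) a _ (P.comul_mul_β h r a b hab)
    rw [P.diagHom_mkM _ _ h a b hab, map_sum, contractBase_mkM, ← mul_smul, ← key,
      Finset.sum_smul]
    refine Finset.sum_congr rfl fun i _ => ?_
    rw [contractBase_mkM, baseHom_apply, counit_mul_α]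
    exact (mul_smul (P.β (op (P.coring.counit (b i * P.β (op r))))) (a i) c).symm

end Contraction

/-! ### The tensor product `C ⊗_H M` -/

variable (ρ : H →ₐ[k] Module.End k M) (σ : H →ₐ[k] Module.End k N)

variable (C) in
/-- The tensor product `C ⊗_H M`, where `C` is a right `H`-module by `c·h = T(h) c`. -/
abbrev TensorH : Type _ :=
  BalancedTensor (fun h : H => Algebra.lsmul k k C (P.T h)) (fun h : H => ρ h)

/-- The bilinear map `(c, m) ↦ c ⊗_H m`. -/
def mkH : C →ₗ[k] M →ₗ[k] P.TensorH C ρ := BalancedTensor.mk _ _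

/-- Since `T² = id`, the defining relation of `⊗_H` can be read from either side: `h` crosses the
sign as `T(h)`. -/
theorem mkH_balance (h : H) (c : C) (m : M) :
    P.mkH ρ (h • c) m = P.mkH ρ c (ρ (P.T h) m) := by
  have := BalancedTensor.tmul_balance (fun h : H => Algebra.lsmul k k C (P.T h))
    (fun h : H => ρ h) (P.T h) c m
  simp only [P.T_T] at this
  exact this

/-- An `H`-balanced bilinear map descends to `C ⊗_H M`. -/
def liftH (f : C →ₗ[k] M →ₗ[k] Q) (hf : ∀ (h : H) c m, f (P.T h • c) m = f c (ρ h m)) :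
    P.TensorH C ρ →ₗ[k] Q :=
  BalancedTensor.liftBilin _ _ f hf

variable {ρ} in
theorem tensorH_ext {f g : P.TensorH C ρ →ₗ[k] Q}
    (h : ∀ c m, f (P.mkH ρ c m) = g (P.mkH ρ c m)) : f = g :=
  BalancedTensor.ext _ _ h

/-- `id ⊗_H f` for an `H`-linear map `f`. -/
def mapH (f : M →ₗ[k] N) (hf : ∀ h m, f (ρ h m) = σ h (f m)) :
    P.TensorH C ρ →ₗ[k] P.TensorH C σ :=
  P.liftH ρ ((P.mkH σ).compl₂ f) (fun h c m => by
    rw [LinearMap.compl₂_apply, LinearMap.compl₂_apply, hf, mkH_balance, P.T_T])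

/-- `h⁽¹⁾ c ⊗_H (h⁽²⁾ m ⊗_R n) = c ⊗_H (m ⊗_R T(h) n)`. -/
theorem sum_mkH_smul (h : H) {ι : Type} [Fintype ι] (a b : ι → H)
    (hab : P.coring.comul h = ∑ i, P.tmulH (a i) (b i)) (c : C) (m : M) (n : N) :
    ∑ i, P.mkH (P.diagHom ρ σ) (a i • c) (P.mkM ρ σ (ρ (b i) m) n) =
      P.mkH (P.diagHom ρ σ) c (P.mkM ρ σ m (σ (P.T h) n)) := by
  have hx : ∀ i, ∃ (q : ℕ) (x y : Fin q → H),
      P.coring.comul (P.T (a i)) = ∑ j, P.tmulH (x j) (y j) :=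
    fun i => BalancedTensor.exists_sum _ _ _
  choose q x y hxy using hx
  have key := congrArg (P.pairingAt ρ σ m n) (P.para h ι a b _ x y hab hxy)
  -- Each `aᵢ` crosses `⊗_H` and becomes `T(aᵢ)` acting diagonally. What remains is an identity in
  -- `M ⊗_R N`, namely the axiom `para` evaluated on `m` and `n`.
  simp only [mkH_balance, ← map_sum]
  congr 1
  simp only [map_sum] at key
  refine Eq.trans (Finset.sum_congr rfl fun i _ => ?_) (key.trans ?_)
  · rw [P.diagHom_mkM ρ σ _ _ _ (hxy i)]
    refine Finset.sum_congr rfl fun j _ => ?_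
    rw [← Module.End.mul_apply, ← map_mul]
    rfl
  · change P.mkM ρ σ (ρ 1 m) (σ (P.T h) n) = _
    rw [map_one, Module.End.one_apply]

/-! ### The operators on `C ⊗_H M` -/

section Operators

variable (K : ModuleCoring P.toBialgebroid C)

/-- The trilinear map `(c, d, m) ↦ c ⊗_H (d ⊗_R m)`. -/
def mkHM : C →ₗ[k] C →ₗ[k] M →ₗ[k] P.TensorH C (P.diagHom (Algebra.lsmul k k C) ρ) :=
  LinearMap.mk₂ k (fun c d => P.mkH (P.diagHom _ ρ) c ∘ₗ P.mkM _ ρ d)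
    (fun m m' n => by rw [map_add, LinearMap.add_comp])
    (fun c m n => by rw [map_smul, LinearMap.smul_comp])
    (fun m n n' => by rw [map_add, LinearMap.comp_add])
    (fun c m n => by rw [map_smul, LinearMap.comp_smul])

theorem mkHM_apply (c d : C) (m : M) :
    P.mkHM ρ c d m = P.mkH (P.diagHom (Algebra.lsmul k k C) ρ) c (P.mkM _ ρ d m) := rfl

/-- The map `C ⊗_R C → Hom(M, C ⊗_H (C ⊗_R M))`. -/
def mkHMLift : P.TensorM (Algebra.lsmul k k C) (Algebra.lsmul k k C) →ₗ[k] M →ₗ[k]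
    P.TensorH C (P.diagHom (Algebra.lsmul k k C) ρ) :=
  P.liftM _ _ (P.mkHM ρ) (fun r c d => LinearMap.ext fun m => by
    -- Here `Tβ = α` is essential: `β(r)` crosses `⊗_H` as `α(r)`, which acts on the factor `d`
    -- only.
    rw [mkHM_apply, mkHM_apply, Algebra.lsmul_apply, mkH_balance, P.T_β, diagHom_α])

theorem mkHMLift_diagHom (h : H)
    (w : P.TensorM (Algebra.lsmul k k C) (Algebra.lsmul k k C)) (m : M) :
    P.mkHMLift ρ (P.diagHom _ _ h w) m = P.mkHMLift ρ w (ρ (P.T h) m) := by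
  obtain ⟨p, a, b, hab⟩ := BalancedTensor.exists_sum _ _ (P.coring.comul h)
  induction w using P.tensorM_induction with
  | h0 => simp only [map_zero, LinearMap.zero_apply]
  | hadd x y hx hy => simp only [map_add, LinearMap.add_apply, hx, hy]
  | hmk c d =>
    rw [P.diagHom_mkM _ _ h a b hab, map_sum, LinearMap.sum_apply]
    exact P.sum_mkH_smul (Algebra.lsmul k k C) ρ h a b hab c d m

/-- The map `C ⊗_H M → C ⊗_H (C ⊗_R M)`, `c ⊗ m ↦ c⁽¹⁾ ⊗ c⁽²⁾ ⊗ m`. -/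
def comulH : P.TensorH C ρ →ₗ[k] P.TensorH C (P.diagHom (Algebra.lsmul k k C) ρ) :=
  P.liftH ρ (P.mkHMLift ρ ∘ₗ K.comul) (fun h c m => by
    -- By `H`-linearity of `Δ`, the element `T(h)` acts diagonally on `c⁽¹⁾ ⊗ c⁽²⁾`; it then passes
    -- to `m` as `T(T(h)) = h`.
    rw [LinearMap.comp_apply, LinearMap.comp_apply, K.comul_smul]
    refine (P.mkHMLift_diagHom ρ (P.T h) (K.comul c) m).trans ?_
    rw [P.T_T])

/-- The trilinear map `(d, m, c) ↦ d ⊗_H (m ⊗_R c)`. -/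
def mkHM' : C →ₗ[k] M →ₗ[k] C →ₗ[k] P.TensorH C (P.diagHom ρ (Algebra.lsmul k k C)) :=
  LinearMap.mk₂ k (fun d m => P.mkH (P.diagHom ρ (Algebra.lsmul k k C)) d ∘ₗ P.mkM ρ _ m)
    (fun m m' n => by rw [map_add, LinearMap.add_comp])
    (fun c m n => by rw [map_smul, LinearMap.smul_comp])
    (fun m n n' => by rw [map_add, LinearMap.comp_add])
    (fun c m n => by rw [map_smul, LinearMap.comp_smul])

theorem mkHM'_apply (d : C) (m : M) (c : C) :
    P.mkHM' ρ d m c = P.mkH (P.diagHom ρ (Algebra.lsmul k k C)) d (P.mkM ρ _ m c) := rfl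

/-- The map `C ⊗_R M → Hom(C, C ⊗_H (M ⊗_R C))`. -/
def rotateAux : P.TensorM (Algebra.lsmul k k C) ρ →ₗ[k] C →ₗ[k]
    P.TensorH C (P.diagHom ρ (Algebra.lsmul k k C)) :=
  P.liftM _ ρ (P.mkHM' ρ) (fun r d m => LinearMap.ext fun c => by
    rw [mkHM'_apply, mkHM'_apply, Algebra.lsmul_apply, mkH_balance, P.T_β, diagHom_α])

theorem rotateAux_diagHom (h : H) (x : P.TensorM (Algebra.lsmul k k C) ρ) (c : C) :
    P.rotateAux ρ (P.diagHom _ ρ h x) c = P.rotateAux ρ x (P.T h • c) := by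
  obtain ⟨p, a, b, hab⟩ := BalancedTensor.exists_sum _ _ (P.coring.comul h)
  induction x using P.tensorM_induction with
  | h0 => simp only [map_zero, LinearMap.zero_apply]
  | hadd x y hx hy => simp only [map_add, LinearMap.add_apply, hx, hy]
  | hmk d m =>
    rw [P.diagHom_mkM _ _ h a b hab, map_sum, LinearMap.sum_apply]
    exact P.sum_mkH_smul ρ (Algebra.lsmul k k C) h a b hab d m c

/-- The map `C ⊗_H (C ⊗_R M) → C ⊗_H (M ⊗_R C)`, `c ⊗ d ⊗ m ↦ d ⊗ m ⊗ c`. -/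
def rotateH : P.TensorH C (P.diagHom (Algebra.lsmul k k C) ρ) →ₗ[k]
    P.TensorH C (P.diagHom ρ (Algebra.lsmul k k C)) :=
  P.liftH _ (P.rotateAux ρ).flip (fun h c x => (P.rotateAux_diagHom ρ h x c).symm)

/-- The map `C ⊗_H C → C ⊗_H C`, `c ⊗ d ↦ d ⊗ c`. -/
def swapH : P.TensorH C (Algebra.lsmul k k C) →ₗ[k] P.TensorH C (Algebra.lsmul k k C) :=
  P.liftH _ (P.mkH (Algebra.lsmul k k C)).flip (fun h c d => by
    rw [LinearMap.flip_apply, LinearMap.flip_apply, Algebra.lsmul_apply, mkH_balance]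
    rfl)

end Operators

end ParaHopfAlgebroid

/-! ### Cocyclic modules generated by the first coface and the first codegeneracy -/

namespace CocyclicModule

variable {k : Type*} [CommRing k] {X : ℕ → Type*} [∀ n, AddCommGroup (X n)] [∀ n, Module k (X n)]
  (t : ∀ n, X n ≃ₗ[k] X n) (d : ∀ n, X n →ₗ[k] X (n + 1)) (s : ∀ n, X (n + 1) →ₗ[k] X n)

/-- The conjugate `t⁻ⁱ d tⁱ`. -/
def conjCoface (n : ℕ) (i : ℤ) : X n →ₗ[k] X (n + 1) :=
  (t (n + 1) ^ (-i)).toLinearMap ∘ₗ d n ∘ₗ (t n ^ i).toLinearMap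

/-- The conjugate `t⁻ⁱ s tⁱ`. -/
def conjCodegeneracy (n : ℕ) (i : ℤ) : X (n + 1) →ₗ[k] X n :=
  (t n ^ (-i)).toLinearMap ∘ₗ s n ∘ₗ (t (n + 1) ^ i).toLinearMap

theorem conjCoface_apply (n : ℕ) (i : ℤ) (x : X n) :
    conjCoface t d n i x = (t (n + 1) ^ (-i)) (d n ((t n ^ i) x)) := rfl

theorem conjCodegeneracy_apply (n : ℕ) (i : ℤ) (x : X (n + 1)) :
    conjCodegeneracy t s n i x = (t n ^ (-i)) (s n ((t (n + 1) ^ i) x)) := rfl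

@[simp] theorem conjCoface_zero (n : ℕ) : conjCoface t d n 0 = d n := by
  ext x
  simp [conjCoface_apply]

@[simp] theorem conjCodegeneracy_zero (n : ℕ) : conjCodegeneracy t s n 0 = s n := by
  ext x
  simp [conjCodegeneracy_apply]

theorem zpow_conjCoface (n : ℕ) (m i : ℤ) (x : X n) :
    (t (n + 1) ^ m) (conjCoface t d n i x) = conjCoface t d n (i - m) ((t n ^ m) x) := by
  rw [conjCoface_apply, conjCoface_apply, ← LinearEquiv.mul_apply, ← LinearEquiv.mul_apply,
    ← zpow_add, ← zpow_add, sub_add_cancel, neg_sub, sub_eq_add_neg]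

theorem zpow_conjCodegeneracy (n : ℕ) (m i : ℤ) (x : X (n + 1)) :
    (t n ^ m) (conjCodegeneracy t s n i x) =
      conjCodegeneracy t s n (i - m) ((t (n + 1) ^ m) x) := by
  rw [conjCodegeneracy_apply, conjCodegeneracy_apply, ← LinearEquiv.mul_apply,
    ← LinearEquiv.mul_apply, ← zpow_add, ← zpow_add, sub_add_cancel, neg_sub, sub_eq_add_neg]

theorem apply_conjCoface (n : ℕ) (i : ℤ) (x : X n) :
    t (n + 1) (conjCoface t d n (i + 1) x) = conjCoface t d n i (t n x) := by
  simpa using zpow_conjCoface t d n 1 (i + 1) x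

theorem apply_conjCodegeneracy (n : ℕ) (i : ℤ) (x : X (n + 1)) :
    t n (conjCodegeneracy t s n (i + 1) x) = conjCodegeneracy t s n i (t (n + 1) x) := by
  simpa using zpow_conjCodegeneracy t s n 1 (i + 1) x

variable {t}

/-- The periods in degrees `n` and `n + 1` differ by one: `tⁿ⁺¹` is trivial on the source, while
`t⁻⁽ⁿ⁺¹⁾ = t` on the target. -/
theorem conjCoface_last (ht : ∀ n, t n ^ (n + 1) = 1) (n : ℕ) (x : X n) :
    conjCoface t d n (n + 1) x = t (n + 1) (d n x) := by
  have h1 : t n ^ ((n : ℤ) + 1) = 1 := by exact_mod_cast ht n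
  have h2 : t (n + 1) ^ (-((n : ℤ) + 1)) = t (n + 1) := by
    rw [zpow_neg, inv_eq_iff_mul_eq_one, ← zpow_add_one]
    exact_mod_cast ht (n + 1)
  rw [conjCoface_apply, h1, h2]
  rfl

theorem conjCodegeneracy_last (ht : ∀ n, t n ^ (n + 1) = 1) (n : ℕ) (x : X (n + 1)) :
    conjCodegeneracy t s n n (t (n + 1) (t (n + 1) x)) = t n (s n x) := by
  have h1 : t n ^ (-(n : ℤ)) = t n := by
    rw [zpow_neg, inv_eq_iff_mul_eq_one, ← zpow_add_one]
    exact_mod_cast ht n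
  have h2 : t (n + 1) ^ (n : ℤ) * t (n + 1) * t (n + 1) = 1 := by
    rw [← zpow_add_one, ← zpow_add_one]
    exact_mod_cast ht (n + 1)
  rw [conjCodegeneracy_apply, h1]
  change t n (s n ((t (n + 1) ^ (n : ℤ) * t (n + 1) * t (n + 1)) x)) = _
  rw [h2]
  rfl

variable (t)

/-- The identities between the generators `d`, `s` and their conjugates which imply the relations
of a cocyclic module. -/
structure Generators : Prop where
  period : ∀ n, t n ^ (n + 1) = 1
  coface : ∀ n (j : ℕ), j ≤ n → ∀ x : X n,
    conjCoface t d (n + 1) (j + 1) (d n x) = d (n + 1) (conjCoface t d n j x)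
  codegeneracy : ∀ n (j : ℕ), j ≤ n → ∀ x : X (n + 2),
    conjCodegeneracy t s n j (s (n + 1) x) = s n (conjCodegeneracy t s (n + 1) (j + 1) x)
  codegeneracy_coface : ∀ n (j : ℕ), j ≤ n → ∀ x : X (n + 1),
    conjCodegeneracy t s (n + 1) (j + 1) (d (n + 1) x) = d n (conjCodegeneracy t s n j x)
  retract_zero : ∀ n (x : X n), s n (d n x) = x
  retract_one : ∀ n (x : X n), s n (conjCoface t d n 1 x) = x
  coface_codegeneracy : ∀ n (i : ℕ), 1 ≤ i → i ≤ n → ∀ x : X (n + 1),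
    s (n + 1) (conjCoface t d (n + 1) (i + 1) x) = conjCoface t d n i (s n x)

namespace Generators

variable {t d s}

/-- The extra case `j = n + 1` is not an independent axiom. The last coface is `t d`, so this case
is the one with `j = 0`, rotated once. -/
theorem coface_of_le (G : Generators t d s) (n j : ℕ) (hj : j ≤ n + 1) (x : X n) :
    conjCoface t d (n + 1) (j + 1) (d n x) = d (n + 1) (conjCoface t d n j x) := by
  rcases hj.eq_or_lt with rfl | hj
  · have h1 := conjCoface_last d G.period (n + 1) (d n x)
    have h2 := conjCoface_last d G.period n x
    have h3 := G.coface n 0 n.zero_le x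
    have h4 := apply_conjCoface t d (n + 1) 0 (d n x)
    push_cast at h1 h2 h3 ⊢
    simp only [conjCoface_zero, zero_add] at h3 h4
    rw [h1, h2, ← h3, h4]
  · exact G.coface n j (by omega) x

/-- For `i = n + 1` both cofaces are last ones, of the form `t d`, and the relation is the case `j =
0` of `codegeneracy_coface`, rotated once. -/
theorem coface_codegeneracy_of_le (G : Generators t d s) (n i : ℕ) (hi : 1 ≤ i) (hi' : i ≤ n + 1) (x : X (n + 1)) :
    s (n + 1) (conjCoface t d (n + 1) (i + 1) x) = conjCoface t d n i (s n x) := by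
  rcases hi'.eq_or_lt with rfl | hi'
  · have h1 := conjCoface_last d G.period (n + 1) x
    have h2 := conjCoface_last d G.period n (s n x)
    have h3 := G.codegeneracy_coface n 0 n.zero_le x
    have h4 := apply_conjCodegeneracy t s (n + 1) 0 (d (n + 1) x)
    push_cast at h1 h2 h3 ⊢
    simp only [conjCodegeneracy_zero, zero_add] at h3 h4
    rw [h1, h2, ← h3, h4]
  · exact G.coface_codegeneracy n i hi (by omega) x

/-- The cocyclic module generated by `t`, `d` and `s`. -/
def toCocyclicModule (G : Generators t d s) : CocyclicModule k X where
  δ n i := conjCoface t d n (i : ℕ)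
  σ n j := conjCodegeneracy t s n (j : ℕ)
  τ n := (t n).toLinearMap
  -- Applying `tⁱ` lowers every index by `i`, so the smaller index becomes `0` and the difference
  -- `m` takes the place of the larger one. The simplicial relations below are reduced in the same
  -- way.
  δ_δ n i j hij := LinearMap.ext fun x => (t (n + 2) ^ ((i : ℕ) : ℤ)).injective (by
    obtain ⟨m, hm⟩ := Nat.exists_eq_add_of_le (Fin.le_def.1 hij)
    have := G.coface_of_le n m (by omega) ((t n ^ ((i : ℕ) : ℤ)) x)
    simp only [LinearMap.comp_apply, zpow_conjCoface, Fin.val_succ, Fin.val_castSucc, hm]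
    push_cast
    simpa [add_assoc] using this)
  σ_σ n i j hij := LinearMap.ext fun x => (t n ^ ((i : ℕ) : ℤ)).injective (by
    obtain ⟨m, hm⟩ := Nat.exists_eq_add_of_le (Fin.le_def.1 hij)
    have := G.codegeneracy n m (by omega) ((t (n + 2) ^ ((i : ℕ) : ℤ)) x)
    simp only [LinearMap.comp_apply, zpow_conjCodegeneracy, Fin.val_succ, Fin.val_castSucc, hm]
    push_cast
    simpa [add_assoc] using this)
  σ_δ_of_le n i j hij := LinearMap.ext fun x => (t (n + 1) ^ ((i : ℕ) : ℤ)).injective (by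
    obtain ⟨m, hm⟩ := Nat.exists_eq_add_of_le (Fin.le_def.1 hij)
    rw [Fin.val_castSucc] at hm
    have := G.codegeneracy_coface n m (by omega) ((t (n + 1) ^ ((i : ℕ) : ℤ)) x)
    simp only [LinearMap.comp_apply, zpow_conjCoface, zpow_conjCodegeneracy, Fin.val_succ,
      Fin.val_castSucc, hm]
    push_cast
    simpa [add_assoc] using this)
  σ_δ_self n i := LinearMap.ext fun x => (t n ^ ((i : ℕ) : ℤ)).injective (by
    have := G.retract_zero n ((t n ^ ((i : ℕ) : ℤ)) x)
    simp only [LinearMap.comp_apply, zpow_conjCoface, zpow_conjCodegeneracy, Fin.val_castSucc,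
      LinearMap.id_apply]
    simpa using this)
  σ_δ_succ n i := LinearMap.ext fun x => (t n ^ ((i : ℕ) : ℤ)).injective (by
    have := G.retract_one n ((t n ^ ((i : ℕ) : ℤ)) x)
    simp only [LinearMap.comp_apply, zpow_conjCoface, zpow_conjCodegeneracy, Fin.val_succ,
      LinearMap.id_apply]
    push_cast
    simpa using this)
  σ_δ_of_gt n i j hij := LinearMap.ext fun x => (t (n + 1) ^ ((j : ℕ) : ℤ)).injective (by
    obtain ⟨m, hm⟩ := Nat.exists_eq_add_of_le (Fin.lt_def.1 hij).le
    rw [Fin.lt_def, Fin.val_castSucc] at hij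
    rw [Fin.val_castSucc] at hm
    have := G.coface_codegeneracy_of_le n m (by omega) (by omega)
      ((t (n + 1) ^ ((j : ℕ) : ℤ)) x)
    simp only [LinearMap.comp_apply, zpow_conjCoface, zpow_conjCodegeneracy, Fin.val_succ,
      Fin.val_castSucc, hm]
    push_cast
    simpa [add_assoc] using this)
  τ_δ_succ n i := LinearMap.ext fun x => by
    simpa using apply_conjCoface t d n (i : ℕ) x
  τ_δ_zero n := LinearMap.ext fun x => by
    simpa using (conjCoface_last d G.period n x).symm
  τ_σ_succ n i := LinearMap.ext fun x => by
    simpa using apply_conjCodegeneracy t s n (i : ℕ) x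
  τ_σ_zero n := LinearMap.ext fun x => by
    simpa using (conjCodegeneracy_last s G.period n x).symm
  τ_pow n := LinearMap.ext fun x => by
    refine Eq.trans ?_ (LinearEquiv.congr_fun (G.period n) x)
    generalize n + 1 = m
    induction m with
    | zero => rfl
    | succ m ih =>
      rw [pow_succ', pow_succ']
      exact congrArg (t n) ih

end Generators

end CocyclicModule

namespace ParaHopfAlgebroid

section

variable {k : Type v} {H : Type w} {R : Type u} [CommRing k] [Ring R] [Algebra k R] [Ring H]
  [Algebra k H] (P : ParaHopfAlgebroid k R H)
  {C : Type u} [AddCommGroup C] [Module k C] [Module H C] [IsScalarTower k H C]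

/-! ### Elementary tensors -/

theorem powMk_cons (n : ℕ) (x : C) (c : Fin (n + 1) → C) :
    P.powMk C (n + 1) (Fin.cons x c) =
      P.mkM (Algebra.lsmul k k C) (P.tensorPowSucc C n).act x (P.powMk C n c) := rfl

theorem powMk_ext {Q : Type*} [AddCommGroup Q] [Module k Q] :
    ∀ (n : ℕ) {f g : (P.tensorPowSucc C n).carrier →ₗ[k] Q}
      (_ : ∀ c, f (P.powMk C n c) = g (P.powMk C n c)), f = g
  | 0, _, _, h => LinearMap.ext fun x => h fun _ => x
  | n + 1, f, g, h => P.tensorM_ext _ _ fun x y => by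
    have := powMk_ext n (f := f ∘ₗ P.mkM _ (P.tensorPowSucc C n).act x)
      (g := g ∘ₗ P.mkM _ (P.tensorPowSucc C n).act x) fun c => h (Fin.cons x c)
    exact LinearMap.congr_fun this y

/-- The element `c₀ ⊗_H c₁ ⊗_R ⋯ ⊗_R cₙ` of `Cⁿ`, where `c₀ ⊗_H 1` is meant for `n = 0`. -/
def cochainMk : (n : ℕ) → (Fin (n + 1) → C) → P.Cochain C n
  | 0, c => P.zeroMk (c 0) 1
  | _ + 1, c => P.succMk c

theorem cochainMk_cons (n : ℕ) (x : C) (c : Fin (n + 1) → C) :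
    P.cochainMk (n + 1) (Fin.cons x c) =
      P.mkH (P.tensorPowSucc C n).act x (P.powMk C n c) := rfl

/-- Since `r = ε(α(r)) = α(r)·1` and `α = Tβ`, the scalar crosses `⊗_H`. So the elements `c ⊗_H 1`
span degree zero, which lets degree zero share formulas with the higher degrees. -/
theorem zeroMk_eq_β (c : C) (r : R) :
    P.zeroMk c r = P.cochainMk 0 (fun _ => P.β (op r) • c) := by
  have := P.mkH_balance P.baseHom (P.β (op r)) c 1
  rw [P.T_β, baseHom_apply, map_one P.α, mul_one, P.counit_α] at this
  exact this.symm

/-- The same argument with `r = ε(β(r))` and `β = Tα`. The comparison with `zeroMk_eq_β` shows that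
`α(r)c ⊗_H 1 = β(r)c ⊗_H 1`. -/
theorem zeroMk_eq_α (c : C) (r : R) :
    P.zeroMk c r = P.cochainMk 0 (fun _ => P.α r • c) := by
  have := P.mkH_balance P.baseHom (P.α r) c 1
  rw [P.T_α, baseHom_apply, map_one P.α, mul_one, P.counit_β] at this
  exact this.symm

theorem cochainMk_ext {Q : Type*} [AddCommGroup Q] [Module k Q] (n : ℕ)
    {f g : P.Cochain C n →ₗ[k] Q} (h : ∀ c, f (P.cochainMk n c) = g (P.cochainMk n c)) :
    f = g := by
  cases n with
  | zero =>
    refine P.tensorH_ext fun c r => ?_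
    exact (congrArg f (P.zeroMk_eq_β c r)).trans
      ((h _).trans (congrArg g (P.zeroMk_eq_β c r).symm))
  | succ n =>
    refine P.tensorH_ext fun x y => ?_
    have := P.powMk_ext n (f := f ∘ₗ P.mkH (P.tensorPowSucc C n).act x)
      (g := g ∘ₗ P.mkH (P.tensorPowSucc C n).act x) fun c => h (Fin.cons x c)
    exact LinearMap.congr_fun this y

theorem α_powMk_cons (n : ℕ) (r : R) (x : C) (c : Fin n → C) :
    (P.tensorPowSucc C n).act (P.α r) (P.powMk C n (Fin.cons x c)) =
      P.powMk C n (Fin.cons (P.α r • x) c) := by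
  cases n with
  | zero => rfl
  | succ n => exact P.diagHom_α _ _ r x (P.powMk C n c)

/-- The sign `⊗_H` is balanced over `R` in the same way as the other signs, since `Tβ = α` and
`α(r)` acts on the first factor of a tensor power. -/
theorem cochainMk_balance (n : ℕ) (r : R) (x y : C) (c : Fin n → C) :
    P.cochainMk (n + 1) (Fin.cons (P.β (op r) • x) (Fin.cons y c)) =
      P.cochainMk (n + 1) (Fin.cons x (Fin.cons (P.α r • y) c)) := by
  rw [cochainMk_cons, cochainMk_cons, mkH_balance, P.T_β, α_powMk_cons]

theorem cochainMk_sum_cons (n : ℕ) {ι : Type*} [Fintype ι] (x : ι → C) (c : Fin n → C) :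
    P.cochainMk n (Fin.cons (∑ i, x i) c) = ∑ i, P.cochainMk n (Fin.cons (x i) c) := by
  cases n with
  | zero =>
    change P.mkH P.baseHom (∑ i, x i) 1 = ∑ i, P.mkH P.baseHom (x i) 1
    rw [map_sum, LinearMap.sum_apply]
  | succ n =>
    simp only [cochainMk_cons, map_sum, LinearMap.sum_apply]
    rfl

theorem powMk_sum_cons (n : ℕ) {ι : Type*} [Fintype ι] (x : ι → C) (c : Fin n → C) :
    P.powMk C n (Fin.cons (∑ i, x i) c) = ∑ i, P.powMk C n (Fin.cons (x i) c) := by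
  cases n with
  | zero => rfl
  | succ n =>
    simp only [powMk_cons, map_sum, LinearMap.sum_apply]
    rfl

theorem cochainMk_sum_cons_cons (n : ℕ) {ι : Type*} [Fintype ι] (x : C) (y : ι → C)
    (c : Fin n → C) :
    P.cochainMk (n + 1) (Fin.cons x (Fin.cons (∑ i, y i) c)) =
      ∑ i, P.cochainMk (n + 1) (Fin.cons x (Fin.cons (y i) c)) := by
  rw [cochainMk_cons, powMk_sum_cons, map_sum]
  rfl

/-! ### The cyclic operator -/

/-- The map `C^{⊗_R (n+1)} ⊗_R C → C^{⊗_R (n+2)}`, together with its `H`-linearity. -/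
def snocHom : (n : ℕ) →
    {f : P.TensorM (P.tensorPowSucc C n).act (Algebra.lsmul k k C) →ₗ[k]
        (P.tensorPowSucc C (n + 1)).carrier //
      ∀ h x, f (P.diagHom (P.tensorPowSucc C n).act (Algebra.lsmul k k C) h x) =
        (P.tensorPowSucc C (n + 1)).act h (f x)}
  | 0 => ⟨LinearMap.id, fun _ _ => rfl⟩
  | n + 1 =>
    -- Tensoring the previous map with the identity requires its `H`-linearity, hence the recursion
    -- on the pair.
    ⟨P.mapM (Algebra.lsmul k k C) (P.diagHom (P.tensorPowSucc C n).act (Algebra.lsmul k k C))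
        (P.tensorPowSucc C (n + 1)).act (snocHom n).1 (snocHom n).2 ∘ₗ
      P.assocMap (Algebra.lsmul k k C) (P.tensorPowSucc C n).act (Algebra.lsmul k k C),
    fun h x => by
      refine (congrArg (P.mapM (Algebra.lsmul k k C)
        (P.diagHom (P.tensorPowSucc C n).act (Algebra.lsmul k k C))
        (P.tensorPowSucc C (n + 1)).act (snocHom n).1 (snocHom n).2)
        (P.assocMap_diagHom _ _ _ h x)).trans ?_
      exact P.mapM_diagHom _ _ _ (snocHom n).1 (snocHom n).2 h _⟩

theorem snocHom_mkM (n : ℕ) (c : Fin (n + 1) → C) (x : C) :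
    (P.snocHom n).1 (P.mkM _ _ (P.powMk C n c) x) = P.powMk C (n + 1) (Fin.snoc c x) := by
  induction n with
  | zero =>
    change P.mkM (Algebra.lsmul k k C) (Algebra.lsmul k k C) (c 0) x = _
    have : (Fin.snoc c x : Fin 2 → C) = Fin.cons (c 0) (fun _ => x) := by
      ext i
      fin_cases i <;> rfl
    rw [this]
    rfl
  | succ n ih =>
    rw [← Fin.cons_self_tail c, ← Fin.cons_snoc_eq_snoc_cons, powMk_cons, powMk_cons, ← ih]
    rfl

/-- The cyclic operator of `Cⁿ`. -/
def rotate : (n : ℕ) → P.Cochain C n →ₗ[k] P.Cochain C n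
  | 0 => LinearMap.id
  | 1 => P.swapH
  -- `rotateH` leaves `c₀` outside the bracket of the tensor power; `snocHom` restores the nesting
  -- to the right.
  | n + 2 => P.mapH _ (P.tensorPowSucc C (n + 1)).act (P.snocHom n).1 (P.snocHom n).2 ∘ₗ
      P.rotateH (P.tensorPowSucc C n).act

theorem rotate_cons (n : ℕ) (x : C) (c : Fin n → C) :
    P.rotate n (P.cochainMk n (Fin.cons x c)) = P.cochainMk n (Fin.snoc c x) := by
  match n, c with
  | 0, c => rfl
  | 1, c =>
    change P.mkH (Algebra.lsmul k k C) (c 0) x = _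
    have : (Fin.snoc c x : Fin 2 → C) = Fin.cons (c 0) (fun _ => x) := by
      ext i
      fin_cases i <;> rfl
    rw [this]
    rfl
  | n + 2, c =>
    rw [← Fin.cons_self_tail c, ← Fin.cons_snoc_eq_snoc_cons, cochainMk_cons P (n + 1) (c 0),
      ← snocHom_mkM]
    rfl

theorem snoc_tail_eq {A : Type*} {n : ℕ} (c : Fin (n + 1) → A) :
    (Fin.snoc (Fin.tail c) (c 0) : Fin (n + 1) → A) = fun i => c (i + 1) := by
  ext i
  refine Fin.lastCases ?_ (fun i => ?_) i
  · simp
  · simp [Fin.tail]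

theorem rotate_cochainMk (n : ℕ) (c : Fin (n + 1) → C) :
    P.rotate n (P.cochainMk n c) = P.cochainMk n fun i => c (i + 1) := by
  conv_lhs => rw [← Fin.cons_self_tail c]
  rw [rotate_cons, snoc_tail_eq]

theorem rotate_pow_cochainMk (n m : ℕ) (c : Fin (n + 1) → C) :
    (P.rotate n ^ m) (P.cochainMk n c) = P.cochainMk n fun i => c (i + m • 1) := by
  induction m generalizing c with
  | zero => simp
  | succ m ih =>
    rw [pow_succ, Module.End.mul_apply, rotate_cochainMk, ih]
    congr 1
    ext i
    rw [succ_nsmul, add_assoc]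

/-- On elementary tensors `τ` translates indices by `1` in the cyclic group `Fin (n + 1)`, which has
order `n + 1`. -/
theorem rotate_pow (n : ℕ) : (P.rotate n ^ (n + 1) : Module.End k (P.Cochain C n)) = 1 :=
  P.cochainMk_ext n fun c => by
    have : (n + 1) • (1 : Fin (n + 1)) = 0 := by
      simpa using card_nsmul_eq_zero (x := (1 : Fin (n + 1)))
    rw [rotate_pow_cochainMk, this]
    simp

/-- The cyclic operator of `Cⁿ` as an automorphism. -/
def rotateEquiv (n : ℕ) : P.Cochain C n ≃ₗ[k] P.Cochain C n :=
  LinearEquiv.ofLinearMap (P.rotate n) (P.rotate n ^ n)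
    ((pow_succ' (P.rotate n) n).symm.trans (P.rotate_pow n))
    ((pow_succ (P.rotate n) n).symm.trans (P.rotate_pow n))

theorem rotateEquiv_apply (n : ℕ) (x : P.Cochain C n) : P.rotateEquiv n x = P.rotate n x := rfl

theorem rotateEquiv_pow (n : ℕ) :
    (P.rotateEquiv n ^ (n + 1) : P.Cochain C n ≃ₗ[k] P.Cochain C n) = 1 :=
  LinearEquiv.ext fun x => by
    refine Eq.trans ?_ (LinearMap.congr_fun (P.rotate_pow n) x)
    generalize n + 1 = m
    induction m with
    | zero => rfl
    | succ m ih =>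
      rw [pow_succ', pow_succ']
      exact congrArg (P.rotate n) ih

/-! ### The first coface and the first codegeneracy -/

variable (K : ModuleCoring P.toBialgebroid C)

/-- The coface `δ₀`. -/
def cofaceZero : (n : ℕ) → P.Cochain C n →ₗ[k] P.Cochain C (n + 1)
  | 0 => P.mapH _ (Algebra.lsmul k k C) P.contractBase P.contractBase_diagHom ∘ₗ
      P.comulH P.baseHom K
  | n + 1 => P.comulH (P.tensorPowSucc C n).act K

/-- The codegeneracy `σ₀`. -/
def codegeneracyZero : (n : ℕ) → P.Cochain C (n + 1) →ₗ[k] P.Cochain C n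
  | 0 => P.mapH _ P.baseHom K.counit K.counit_smul
  | n + 1 => P.mapH _ (P.tensorPowSucc C n).act (P.contractLeft K (P.tensorPowSucc C n).act)
      (P.contractLeft_diagHom K (P.tensorPowSucc C n).act)

theorem cofaceZero_cons (n : ℕ) (x : C) (c : Fin n → C) {ι : Type} [Fintype ι] (a b : ι → C)
    (hab : K.comul x = ∑ i, P.tmulM (Algebra.lsmul k k C) (Algebra.lsmul k k C) (a i) (b i)) :
    P.cofaceZero K n (P.cochainMk n (Fin.cons x c)) =
      ∑ i, P.cochainMk (n + 1) (Fin.cons (a i) (Fin.cons (b i) c)) := by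
  cases n with
  | zero =>
    change P.mapH _ _ P.contractBase P.contractBase_diagHom (P.mkHMLift P.baseHom (K.comul x) 1) = _
    rw [hab]
    simp only [map_sum, LinearMap.sum_apply]
    refine Finset.sum_congr rfl fun i _ => ?_
    change P.mkH (Algebra.lsmul k k C) (a i) (P.β (op 1) • b i) = _
    -- The element of `R` is `1`, by the convention for `cochainMk` in degree zero, so its right
    -- action disappears.
    rw [MulOpposite.op_one, map_one, one_smul]
    rfl
  | succ n =>
    change P.mkHMLift (P.tensorPowSucc C n).act (K.comul x) (P.powMk C n c) = _
    rw [hab]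
    simp only [map_sum, LinearMap.sum_apply]
    rfl

/-- In positive degree `ε(y)` acts by `α` on the factor after `y`; crossing `⊗_H` moves it to `x` as
`β(ε(y))`. This form also covers degree zero, where no next factor exists. -/
theorem codegeneracyZero_cons (n : ℕ) (x y : C) (c : Fin n → C) :
    P.codegeneracyZero K n (P.cochainMk (n + 1) (Fin.cons x (Fin.cons y c))) =
      P.cochainMk n (Fin.cons (P.β (op (K.counit y)) • x) c) := by
  cases n with
  | zero =>
    change P.zeroMk x (K.counit y) = _
    rw [zeroMk_eq_β]
    rfl
  | succ n =>
    rw [P.cochainMk_cons n, mkH_balance, P.T_β]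
    rfl

end

end ParaHopfAlgebroid

/-! ### Insertion and removal of entries in tuples extended at either end -/

namespace Fin

variable {A : Type*} {n : ℕ}

theorem insertNth_castSucc_snoc (p : Fin (n + 1)) (a x : A) (c : Fin n → A) :
    (insertNth p.castSucc a (snoc c x) : Fin (n + 2) → A) = snoc (insertNth p a c) x := by
  ext j
  cases j using Fin.succAboveCases p.castSucc with
  | x => simp
  | p j =>
    simp only [insertNth_apply_succAbove]
    cases j using Fin.lastCases <;> simp

theorem removeNth_succ_cons (p : Fin (n + 1)) (x : A) (c : Fin (n + 1) → A) :
    (removeNth (α := fun _ => A) p.succ (cons x c) : Fin (n + 1) → A) = cons x (removeNth p c) := by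
  ext j
  cases j using Fin.cases <;> simp [removeNth]

theorem removeNth_castSucc_snoc (p : Fin (n + 1)) (x : A) (c : Fin (n + 1) → A) :
    (removeNth (α := fun _ => A) p.castSucc (snoc c x) : Fin (n + 1) → A) = snoc (removeNth p c) x := by
  ext j
  cases j using Fin.lastCases <;> simp [removeNth]

end Fin

namespace ParaHopfAlgebroid

section

variable {k : Type v} {H : Type w} {R : Type u} [CommRing k] [Ring R] [Algebra k R] [Ring H]
  [Algebra k H] (P : ParaHopfAlgebroid k R H)
  {C : Type u} [AddCommGroup C] [Module k C] [Module H C] [IsScalarTower k H C]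
  (K : ModuleCoring P.toBialgebroid C)

/-! ### The cofaces and the codegeneracies on elementary tensors -/

/-- The coface `δᵢ`. -/
abbrev coface (n : ℕ) (i : ℤ) : P.Cochain C n →ₗ[k] P.Cochain C (n + 1) :=
  CocyclicModule.conjCoface P.rotateEquiv (P.cofaceZero K) n i

/-- The codegeneracy `σⱼ`. -/
abbrev codegeneracy (n : ℕ) (j : ℤ) : P.Cochain C (n + 1) →ₗ[k] P.Cochain C n :=
  CocyclicModule.conjCodegeneracy P.rotateEquiv (P.codegeneracyZero K) n j

theorem coface_cochainMk (n : ℕ) (j : Fin (n + 1)) (c : Fin (n + 1) → C) {ι : Type} [Fintype ι]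
    (a b : ι → C)
    (hab : K.comul (c j) = ∑ i, P.tmulM (Algebra.lsmul k k C) (Algebra.lsmul k k C) (a i) (b i)) :
    P.coface K n (j : ℕ) (P.cochainMk n c) =
      ∑ i, P.cochainMk (n + 1) (j.castSucc.insertNth (α := fun _ => C) (a i)
        (Function.update c j (b i))) := by
  induction j using Fin.induction generalizing c with
  | zero =>
    obtain ⟨x, c, rfl⟩ : ∃ x c', c = Fin.cons x c' := ⟨_, _, (Fin.cons_self_tail c).symm⟩
    rw [Fin.val_zero, Nat.cast_zero, coface, CocyclicModule.conjCoface_zero,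
      P.cofaceZero_cons K n x c a b hab]
    simp only [Fin.castSucc_zero, Fin.insertNth_zero', Fin.update_cons_zero]
  | succ j ih =>
    obtain ⟨x, c, rfl⟩ : ∃ x c', c = Fin.cons x c' := ⟨_, _, (Fin.cons_self_tail c).symm⟩
    -- The relation `τ δⱼ₊₁ = δⱼ τ` lowers the index: rotation carries the leading entry to the end,
    -- away from the entry being split.
    refine (P.rotateEquiv (n + 1)).injective ?_
    rw [Fin.val_succ, Nat.cast_succ, CocyclicModule.apply_conjCoface, rotateEquiv_apply,
      rotate_cons, map_sum]
    refine (ih (Fin.snoc c x) (by simpa using hab)).trans (Finset.sum_congr rfl fun i _ => ?_)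
    rw [rotateEquiv_apply, ← Fin.snoc_update, Fin.insertNth_castSucc_snoc, ← rotate_cons,
      ← Fin.cons_update, ← Fin.insertNth_succ_cons, Fin.succ_castSucc]

/-- The tuple obtained from `c` by removing its entry of index `j + 1` after letting the counit of
this entry act from the right on the preceding entry. -/
def contractNth {n : ℕ} (j : Fin n) (c : Fin (n + 1) → C) : Fin n → C :=
  j.succ.removeNth (Function.update c j.castSucc (P.β (op (K.counit (c j.succ))) • c j.castSucc))

theorem contractNth_succ_cons {n : ℕ} (j : Fin n) (x : C) (c : Fin (n + 1) → C) :
    P.contractNth K j.succ (Fin.cons x c) = Fin.cons x (P.contractNth K j c) := by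
  rw [contractNth, contractNth, ← Fin.removeNth_succ_cons, Fin.cons_update, ← Fin.succ_castSucc]
  simp only [Fin.cons_succ]

theorem contractNth_castSucc_snoc {n : ℕ} (j : Fin n) (x : C) (c : Fin (n + 1) → C) :
    P.contractNth K j.castSucc (Fin.snoc c x) = Fin.snoc (P.contractNth K j c) x := by
  rw [contractNth, contractNth, ← Fin.removeNth_castSucc_snoc, Fin.snoc_update, Fin.succ_castSucc]
  simp only [Fin.snoc_castSucc]

theorem contractNth_zero_cons_cons {n : ℕ} (x y : C) (c : Fin n → C) :
    P.contractNth K 0 (Fin.cons x (Fin.cons y c)) =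
      Fin.cons (P.β (op (K.counit y)) • x) c := by
  rw [contractNth, Fin.castSucc_zero, Fin.update_cons_zero, Fin.removeNth_succ_cons,
    Fin.removeNth_zero]
  rfl

theorem codegeneracy_cochainMk (n : ℕ) (j : Fin (n + 1)) (c : Fin (n + 2) → C) :
    P.codegeneracy K n (j : ℕ) (P.cochainMk (n + 1) c) =
      P.cochainMk n (P.contractNth K j c) := by
  induction j using Fin.induction generalizing c with
  | zero =>
    obtain ⟨x, c, rfl⟩ : ∃ x c', c = Fin.cons x c' := ⟨_, _, (Fin.cons_self_tail c).symm⟩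
    obtain ⟨y, c, rfl⟩ : ∃ x c', c = Fin.cons x c' := ⟨_, _, (Fin.cons_self_tail c).symm⟩
    rw [Fin.val_zero, Nat.cast_zero, codegeneracy, CocyclicModule.conjCodegeneracy_zero,
      codegeneracyZero_cons, contractNth_zero_cons_cons]
  | succ j ih =>
    obtain ⟨x, c, rfl⟩ : ∃ x c', c = Fin.cons x c' := ⟨_, _, (Fin.cons_self_tail c).symm⟩
    refine (P.rotateEquiv n).injective ?_
    rw [Fin.val_succ, Nat.cast_succ, CocyclicModule.apply_conjCodegeneracy, rotateEquiv_apply,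
      rotate_cons, rotateEquiv_apply, contractNth_succ_cons, rotate_cons,
      ← contractNth_castSucc_snoc]
    exact ih (Fin.snoc c x)

theorem coface_succ_cons (n : ℕ) (j : Fin n) (x : C) (c : Fin n → C) {ι : Type} [Fintype ι]
    (a b : ι → C)
    (hab : K.comul (c j) = ∑ i, P.tmulM (Algebra.lsmul k k C) (Algebra.lsmul k k C) (a i) (b i)) :
    P.coface K n ((j : ℕ) + 1) (P.cochainMk n (Fin.cons x c)) =
      ∑ i, P.cochainMk (n + 1) (Fin.cons x (j.castSucc.insertNth (α := fun _ => C) (a i)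
        (Function.update c j (b i)))) := by
  have := P.coface_cochainMk K n j.succ (Fin.cons x c) a b hab
  simpa only [Fin.val_succ, Nat.cast_succ, ← Fin.cons_update, ← Fin.succ_castSucc,
    Fin.insertNth_succ_cons] using this

theorem codegeneracy_succ_cons (n : ℕ) (j : Fin n) (x : C) (c : Fin (n + 1) → C) :
    P.codegeneracy K n ((j : ℕ) + 1) (P.cochainMk (n + 1) (Fin.cons x c)) =
      P.cochainMk n (Fin.cons x (P.contractNth K j c)) := by
  have := P.codegeneracy_cochainMk K n j.succ (Fin.cons x c)
  simpa only [Fin.val_succ, Nat.cast_succ, contractNth_succ_cons] using this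

/-! ### Coassociativity -/

/-- The map `w ↦ w ⊗_R c₁ ⊗_R ⋯ ⊗_R cₙ` on `C ⊗_R C`. -/
def powInsert : (n : ℕ) → (Fin n → C) →
    P.TensorM (Algebra.lsmul k k C) (Algebra.lsmul k k C) →ₗ[k] (P.tensorPowSucc C (n + 1)).carrier
  | 0, _ => LinearMap.id
  | n + 1, c => (P.assocAux (Algebra.lsmul k k C) (Algebra.lsmul k k C)
      (P.tensorPowSucc C n).act).flip (P.powMk C n c)

theorem powInsert_mkM (n : ℕ) (c : Fin n → C) (x y : C) :
    P.powInsert n c (P.mkM _ _ x y) = P.powMk C (n + 1) (Fin.cons x (Fin.cons y c)) := by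
  cases n <;> rfl

theorem powInsert_left (n : ℕ) (c : Fin n → C) (r : R)
    (w : P.TensorM (Algebra.lsmul k k C) (Algebra.lsmul k k C)) :
    P.powInsert n c (((P.bimodule (Algebra.lsmul k k C)).tensor
      (P.bimodule (Algebra.lsmul k k C))).left r w) =
      (P.tensorPowSucc C (n + 1)).act (P.α r) (P.powInsert n c w) := by
  induction w using P.tensorM_induction with
  | h0 => simp only [map_zero]
  | hadd x y hx hy => simp only [map_add, hx, hy]
  | hmk x y =>
    rw [powInsert_mkM, α_powMk_cons]
    exact P.powInsert_mkM n c (P.α r • x) y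

/-- The map `x ⊗ w ↦ x ⊗_H w ⊗_R c₁ ⊗_R ⋯ ⊗_R cₙ` on `C ⊗_R (C ⊗_R C)`. -/
def cochainInsert (n : ℕ) (c : Fin n → C) :
    (P.bimodule (Algebra.lsmul k k C)).Tensor ((P.bimodule (Algebra.lsmul k k C)).tensor
      (P.bimodule (Algebra.lsmul k k C))) →ₗ[k] P.Cochain C (n + 2) :=
  BalancedTensor.liftBilin _ _
    ((P.mkH (P.tensorPowSucc C (n + 1)).act).compl₂ (P.powInsert n c)) (fun r x w => by
      refine (P.mkH_balance (P.tensorPowSucc C (n + 1)).act (P.β (op r)) x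
        (P.powInsert n c w)).trans ?_
      rw [P.T_β, ← powInsert_left]
      rfl)

theorem cochainInsert_tmul (n : ℕ) (c : Fin n → C) (x : C)
    (w : P.TensorM (Algebra.lsmul k k C) (Algebra.lsmul k k C)) :
    P.cochainInsert n c (RBimodule.tmul _ _ x w) =
      P.mkH (P.tensorPowSucc C (n + 1)).act x (P.powInsert n c w) := rfl

theorem cochainInsert_tmul_sum (n : ℕ) (c : Fin n → C) (x : C) {ι : Type} [Fintype ι]
    (a b : ι → C) :
    P.cochainInsert n c (RBimodule.tmul _ _ x
        (∑ i, P.tmulM (Algebra.lsmul k k C) (Algebra.lsmul k k C) (a i) (b i))) =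
      ∑ i, P.cochainMk (n + 2) (Fin.cons x (Fin.cons (a i) (Fin.cons (b i) c))) := by
  rw [cochainInsert_tmul]
  simp only [map_sum]
  refine Finset.sum_congr rfl fun i _ => ?_
  rw [P.cochainMk_cons (n + 1), ← powInsert_mkM]
  rfl

theorem cochainInsert_assoc_sum (n : ℕ) (c : Fin n → C) (x : C) {ι : Type} [Fintype ι]
    (a b : ι → C) :
    P.cochainInsert n c (RBimodule.assoc _ _ _ x
        (∑ i, P.tmulM (Algebra.lsmul k k C) (Algebra.lsmul k k C) (a i) (b i))) =
      ∑ i, P.cochainMk (n + 2) (Fin.cons (a i) (Fin.cons (b i) (Fin.cons x c))) := by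
  simp only [map_sum]
  refine Finset.sum_congr rfl fun i _ => ?_
  rw [P.cochainMk_cons (n + 1), ← powInsert_mkM]
  rfl

/-- The images of the two sides of the coassociativity of `C` under `cochainInsert`, which exists
because `⊗_H` is balanced over `R`. -/
theorem cofaceZero_cofaceZero (n : ℕ) (x : P.Cochain C n) :
    P.coface K (n + 1) 1 (P.cofaceZero K n x) = P.cofaceZero K (n + 1) (P.cofaceZero K n x) := by
  suffices h : P.coface K (n + 1) 1 ∘ₗ P.cofaceZero K n =
      P.cofaceZero K (n + 1) ∘ₗ P.cofaceZero K n from LinearMap.congr_fun h x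
  refine P.cochainMk_ext n fun c => ?_
  obtain ⟨x, c, rfl⟩ : ∃ x c', c = Fin.cons x c' := ⟨_, _, (Fin.cons_self_tail c).symm⟩
  obtain ⟨p, a, b, hab⟩ := BalancedTensor.exists_sum _ _ (K.comul x)
  have key := congrArg (P.cochainInsert n c) (K.coassoc x (Fin p) a b hab)
  rw [map_sum, map_sum] at key
  rw [LinearMap.comp_apply, LinearMap.comp_apply, P.cofaceZero_cons K n x c a b hab, map_sum,
    map_sum]
  refine (Finset.sum_congr rfl fun i _ => ?_).trans
    (key.trans (Finset.sum_congr rfl fun i _ => ?_))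
  · obtain ⟨q, a', b', hab'⟩ := BalancedTensor.exists_sum _ _ (K.comul (b i))
    have := P.coface_succ_cons K (n + 1) 0 (a i) (Fin.cons (b i) c) a' b' hab'
    rw [Fin.val_zero, Nat.cast_zero, zero_add] at this
    rw [this, hab', cochainInsert_tmul_sum]
    simp only [Fin.castSucc_zero, Fin.insertNth_zero', Fin.update_cons_zero]
  · obtain ⟨q, a', b', hab'⟩ := BalancedTensor.exists_sum _ _ (K.comul (a i))
    rw [hab', P.cofaceZero_cons K (n + 1) (a i) (Fin.cons (b i) c) a' b' hab',
      cochainInsert_assoc_sum]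

/-! ### The relations between the generators -/

/-- Coassociativity for `j = 0`; for `j ≥ 1` the two cofaces split different factors. -/
theorem coface_cofaceZero (n j : ℕ) (hj : j ≤ n) (x : P.Cochain C n) :
    P.coface K (n + 1) (j + 1) (P.cofaceZero K n x) =
      P.cofaceZero K (n + 1) (P.coface K n j x) := by
  cases j with
  | zero => simpa using P.cofaceZero_cofaceZero K n x
  | succ j =>
    suffices h : P.coface K (n + 1) ((j + 1 : ℕ) + 1) ∘ₗ P.cofaceZero K n =
        P.cofaceZero K (n + 1) ∘ₗ P.coface K n (j + 1 : ℕ) from LinearMap.congr_fun h x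
    refine P.cochainMk_ext n fun c => ?_
    obtain ⟨x, c, rfl⟩ : ∃ x c', c = Fin.cons x c' := ⟨_, _, (Fin.cons_self_tail c).symm⟩
    obtain ⟨p, a, b, hab⟩ := BalancedTensor.exists_sum _ _ (K.comul x)
    obtain ⟨q, a', b', hab'⟩ := BalancedTensor.exists_sum _ _ (K.comul (c ⟨j, hj⟩))
    have h1 := P.coface_succ_cons K n ⟨j, hj⟩ x c a' b' hab'
    have h2 := fun i => P.coface_succ_cons K (n + 1) (Fin.succ ⟨j, hj⟩) (a i)
      (Fin.cons (b i) c) a' b' hab'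
    rw [LinearMap.comp_apply, LinearMap.comp_apply]
    simp only [Fin.val_succ] at h2
    push_cast at h1 h2 ⊢
    rw [P.cofaceZero_cons K n x c a b hab, h1,
      map_sum, map_sum]
    simp only [P.cofaceZero_cons K (n + 1) x _ a b hab, h2]
    rw [Finset.sum_comm]
    refine Finset.sum_congr rfl fun i _ => Finset.sum_congr rfl fun l _ => ?_
    rw [← Fin.succ_castSucc, ← Fin.cons_update, Fin.insertNth_succ_cons]

theorem codegeneracy_codegeneracyZero (n j : ℕ) (hj : j ≤ n) (x : P.Cochain C (n + 2)) :
    P.codegeneracy K n j (P.codegeneracyZero K (n + 1) x) =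
      P.codegeneracyZero K n (P.codegeneracy K (n + 1) (j + 1) x) := by
  suffices h : P.codegeneracy K n j ∘ₗ P.codegeneracyZero K (n + 1) =
      P.codegeneracyZero K n ∘ₗ P.codegeneracy K (n + 1) (j + 1) from LinearMap.congr_fun h x
  refine P.cochainMk_ext (n + 2) fun c => ?_
  obtain ⟨x, c, rfl⟩ : ∃ x c', c = Fin.cons x c' := ⟨_, _, (Fin.cons_self_tail c).symm⟩
  obtain ⟨y, c, rfl⟩ : ∃ x c', c = Fin.cons x c' := ⟨_, _, (Fin.cons_self_tail c).symm⟩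
  have h1 := P.codegeneracy_succ_cons K (n + 1) ⟨j, by omega⟩ x (Fin.cons y c)
  dsimp only at h1
  rw [LinearMap.comp_apply, LinearMap.comp_apply, codegeneracyZero_cons, h1]
  cases j with
  | zero =>
    obtain ⟨z, c, rfl⟩ : ∃ x c', c = Fin.cons x c' := ⟨_, _, (Fin.cons_self_tail c).symm⟩
    have h2 := P.contractNth_zero_cons_cons K y z c
    rw [Nat.cast_zero, codegeneracy, CocyclicModule.conjCodegeneracy_zero, codegeneracyZero_cons]
    refine Eq.trans ?_ (congrArg (fun c' => P.codegeneracyZero K n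
      (P.cochainMk (n + 1) (Fin.cons x c'))) h2).symm
    -- Both sides are `β(ε(z)) β(ε(y)) x`: right linearity of `ε` gives `ε(β(ε(z)) y) = ε(y) ε(z)`,
    -- and `β` reverses the product.
    rw [codegeneracyZero_cons, counit_β_smul, MulOpposite.op_mul, map_mul, mul_smul]
  | succ j =>
    have h2 := P.contractNth_succ_cons K ⟨j, hj⟩ y c
    have h3 := P.codegeneracy_succ_cons K n ⟨j, hj⟩ (P.β (op (K.counit y)) • x) c
    refine Eq.trans ?_ (congrArg (fun c' => P.codegeneracyZero K n
      (P.cochainMk (n + 1) (Fin.cons x c'))) h2).symm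
    rw [codegeneracyZero_cons, Nat.cast_succ]
    exact h3

theorem comul_β_smul (r : R) (x : C) {ι : Type} [Fintype ι] (a b : ι → C)
    (hab : K.comul x = ∑ i, P.tmulM (Algebra.lsmul k k C) (Algebra.lsmul k k C) (a i) (b i)) :
    K.comul (P.β (op r) • x) =
      ∑ i, P.tmulM (Algebra.lsmul k k C) (Algebra.lsmul k k C) (a i) (P.β (op r) • b i) := by
  have := K.comul_right r x
  rw [hab, map_sum] at this
  exact this

/-- For `j = 0` this is right `R`-linearity of `Δ`: the counit of the second entry acts on `c₀⁽²⁾`.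
For `j ≥ 1` the operations do not meet. -/
theorem codegeneracy_cofaceZero (n j : ℕ) (hj : j ≤ n) (x : P.Cochain C (n + 1)) :
    P.codegeneracy K (n + 1) (j + 1) (P.cofaceZero K (n + 1) x) =
      P.cofaceZero K n (P.codegeneracy K n j x) := by
  suffices h : P.codegeneracy K (n + 1) (j + 1) ∘ₗ P.cofaceZero K (n + 1) =
      P.cofaceZero K n ∘ₗ P.codegeneracy K n j from LinearMap.congr_fun h x
  refine P.cochainMk_ext (n + 1) fun c => ?_
  obtain ⟨x, c, rfl⟩ : ∃ x c', c = Fin.cons x c' := ⟨_, _, (Fin.cons_self_tail c).symm⟩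
  obtain ⟨p, a, b, hab⟩ := BalancedTensor.exists_sum _ _ (K.comul x)
  have h1 := fun i => P.codegeneracy_succ_cons K (n + 1) ⟨j, by omega⟩ (a i) (Fin.cons (b i) c)
  dsimp only at h1
  rw [LinearMap.comp_apply, LinearMap.comp_apply, P.cofaceZero_cons K (n + 1) x c a b hab,
    map_sum]
  simp only [h1]
  cases j with
  | zero =>
    obtain ⟨y, c, rfl⟩ : ∃ x c', c = Fin.cons x c' := ⟨_, _, (Fin.cons_self_tail c).symm⟩
    rw [Nat.cast_zero, codegeneracy, CocyclicModule.conjCodegeneracy_zero, codegeneracyZero_cons,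
      P.cofaceZero_cons K n _ c _ _ (P.comul_β_smul K (K.counit y) x a b hab)]
    refine Finset.sum_congr rfl fun i _ => ?_
    exact congrArg (fun c' => P.cochainMk (n + 1) (Fin.cons (a i) c'))
      (P.contractNth_zero_cons_cons K (b i) y c)
  | succ j =>
    have h3 := P.codegeneracy_succ_cons K n ⟨j, hj⟩ x c
    dsimp only at h3
    rw [Nat.cast_succ, h3, P.cofaceZero_cons K n x _ a b hab]
    refine Finset.sum_congr rfl fun i _ => ?_
    exact congrArg (fun c' => P.cochainMk (n + 1) (Fin.cons (a i) c'))
      (P.contractNth_succ_cons K ⟨j, hj⟩ (b i) c)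

theorem codegeneracyZero_cofaceZero (n : ℕ) (x : P.Cochain C n) :
    P.codegeneracyZero K n (P.cofaceZero K n x) = x := by
  suffices h : P.codegeneracyZero K n ∘ₗ P.cofaceZero K n = LinearMap.id from
    LinearMap.congr_fun h x
  refine P.cochainMk_ext n fun c => ?_
  obtain ⟨x, c, rfl⟩ : ∃ x c', c = Fin.cons x c' := ⟨_, _, (Fin.cons_self_tail c).symm⟩
  obtain ⟨p, a, b, hab⟩ := BalancedTensor.exists_sum _ _ (K.comul x)
  have key := K.comul_counit x (Fin p) a b hab
  rw [LinearMap.comp_apply, P.cofaceZero_cons K n x c a b hab, map_sum, LinearMap.id_apply]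
  simp only [codegeneracyZero_cons]
  rw [← cochainMk_sum_cons]
  exact congrArg (fun y => P.cochainMk n (Fin.cons y c)) key

theorem codegeneracyZero_coface_one (n : ℕ) (x : P.Cochain C n) :
    P.codegeneracyZero K n (P.coface K n 1 x) = x := by
  suffices h : P.codegeneracyZero K n ∘ₗ P.coface K n 1 = LinearMap.id from
    LinearMap.congr_fun h x
  clear x
  refine P.cochainMk_ext n fun c => ?_
  obtain ⟨x, c, rfl⟩ : ∃ x c', c = Fin.cons x c' := ⟨_, _, (Fin.cons_self_tail c).symm⟩
  cases n with
  | zero =>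
    obtain ⟨p, a, b, hab⟩ := BalancedTensor.exists_sum _ _ (K.comul x)
    have key := K.counit_comul x (Fin p) a b hab
    have h1 := CocyclicModule.conjCoface_last (P.cofaceZero K) P.rotateEquiv_pow 0
      (P.cochainMk 0 (Fin.cons x c))
    rw [Nat.cast_zero, zero_add (1 : ℤ), rotateEquiv_apply, P.cofaceZero_cons K 0 x c a b hab] at h1
    rw [LinearMap.comp_apply, h1, map_sum, map_sum, LinearMap.id_apply]
    refine Eq.trans (Finset.sum_congr rfl fun i _ => ?_)
      ((P.cochainMk_sum_cons 0 (fun i => P.α (K.counit (a i)) • b i) c).symm.trans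
        (congrArg (fun y => P.cochainMk 0 (Fin.cons y c)) key))
    have : (Fin.snoc (Fin.cons (b i) c) (a i) : Fin 2 → C) =
        Fin.cons (b i) (Fin.cons (a i) c) := by
      ext l
      fin_cases l <;> rfl
    rw [rotate_cons, this, codegeneracyZero_cons]
    -- The factors are interchanged, so `ε(c⁽¹⁾)` arrives as a right action on `c⁽²⁾`. In degree
    -- zero it may be replaced by the left action that the counit axiom requires.
    exact (P.zeroMk_eq_β (b i) (K.counit (a i))).symm.trans (P.zeroMk_eq_α _ _)
  | succ n =>
    obtain ⟨y, c, rfl⟩ : ∃ x c', c = Fin.cons x c' := ⟨_, _, (Fin.cons_self_tail c).symm⟩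
    obtain ⟨p, a, b, hab⟩ := BalancedTensor.exists_sum _ _ (K.comul y)
    have key := K.counit_comul y (Fin p) a b hab
    have h1 := P.coface_succ_cons K (n + 1) 0 x (Fin.cons y c) a b hab
    rw [Fin.val_zero, Nat.cast_zero, zero_add] at h1
    simp only [Fin.castSucc_zero, Fin.insertNth_zero', Fin.update_cons_zero] at h1
    rw [LinearMap.comp_apply, h1, map_sum, LinearMap.id_apply]
    -- The scalar `ε(y⁽¹⁾)` acts from the right on `x`; balancing moves it to the left of `y⁽²⁾`.
    simp only [codegeneracyZero_cons, cochainMk_balance]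
    rw [← cochainMk_sum_cons_cons]
    exact congrArg (fun z => P.cochainMk (n + 1) (Fin.cons x (Fin.cons z c))) key

theorem codegeneracyZero_coface (n i : ℕ) (hi : 1 ≤ i) (hi' : i ≤ n) (x : P.Cochain C (n + 1)) :
    P.codegeneracyZero K (n + 1) (P.coface K (n + 1) (i + 1) x) =
      P.coface K n i (P.codegeneracyZero K n x) := by
  suffices h : P.codegeneracyZero K (n + 1) ∘ₗ P.coface K (n + 1) (i + 1) =
      P.coface K n i ∘ₗ P.codegeneracyZero K n from LinearMap.congr_fun h x
  refine P.cochainMk_ext (n + 1) fun c => ?_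
  obtain ⟨x, c, rfl⟩ : ∃ x c', c = Fin.cons x c' := ⟨_, _, (Fin.cons_self_tail c).symm⟩
  obtain ⟨y, c, rfl⟩ : ∃ x c', c = Fin.cons x c' := ⟨_, _, (Fin.cons_self_tail c).symm⟩
  obtain ⟨i, rfl⟩ := Nat.exists_eq_add_of_le' hi
  obtain ⟨p, a, b, hab⟩ := BalancedTensor.exists_sum _ _ (K.comul (c ⟨i, hi'⟩))
  have h1 := P.coface_succ_cons K (n + 1) (Fin.succ ⟨i, hi'⟩) x (Fin.cons y c) a b hab
  have h2 := P.coface_succ_cons K n ⟨i, hi'⟩ (P.β (op (K.counit y)) • x) c a b hab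
  rw [LinearMap.comp_apply, LinearMap.comp_apply]
  rw [Fin.val_succ] at h1
  push_cast at h1 h2 ⊢
  rw [h1, codegeneracyZero_cons, h2, map_sum]
  refine Finset.sum_congr rfl fun l _ => ?_
  rw [← Fin.succ_castSucc, ← Fin.cons_update, Fin.insertNth_succ_cons, codegeneracyZero_cons]

theorem generators :
    CocyclicModule.Generators P.rotateEquiv (P.cofaceZero K) (P.codegeneracyZero K) where
  period := P.rotateEquiv_pow
  coface := P.coface_cofaceZero K
  codegeneracy := P.codegeneracy_codegeneracyZero K
  codegeneracy_coface := P.codegeneracy_cofaceZero K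
  retract_zero := P.codegeneracyZero_cofaceZero K
  retract_one := P.codegeneracyZero_coface_one K
  coface_codegeneracy := P.codegeneracyZero_coface K

end

end ParaHopfAlgebroid

/-! ### Extensionality of cocyclic modules -/

namespace CocyclicModule

theorem ext_of_maps {k : Type*} [CommRing k] {X : ℕ → Type*} [∀ n, AddCommGroup (X n)]
    [∀ n, Module k (X n)] {Y Z : CocyclicModule k X} (hδ : ∀ n i, Y.δ n i = Z.δ n i)
    (hσ : ∀ n j, Y.σ n j = Z.σ n j) (hτ : ∀ n, Y.τ n = Z.τ n) : Y = Z := by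
  have hδ' : Y.δ = Z.δ := funext fun n => funext (hδ n)
  have hσ' : Y.σ = Z.σ := funext fun n => funext (hσ n)
  have hτ' : Y.τ = Z.τ := funext hτ
  cases Y
  cases Z
  subst hδ' hσ' hτ'
  rfl

end CocyclicModule

/-! ### The last coface, and the two placements of the counit in a codegeneracy -/

namespace ParaHopfAlgebroid

section

variable {k : Type v} {H : Type w} {R : Type u} [CommRing k] [Ring R] [Algebra k R] [Ring H]
  [Algebra k H] (P : ParaHopfAlgebroid k R H)
  {C : Type u} [AddCommGroup C] [Module k C] [Module H C] [IsScalarTower k H C]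
  (K : ModuleCoring P.toBialgebroid C)

theorem comul_α_smul (r : R) (x : C) {ι : Type} [Fintype ι] (a b : ι → C)
    (hab : K.comul x = ∑ i, P.tmulM (Algebra.lsmul k k C) (Algebra.lsmul k k C) (a i) (b i)) :
    K.comul (P.α r • x) =
      ∑ i, P.tmulM (Algebra.lsmul k k C) (Algebra.lsmul k k C) (P.α r • a i) (b i) := by
  have := K.comul_left r x
  rw [hab, map_sum] at this
  exact this

theorem coface_last_cons (n : ℕ) (x : C) (c : Fin n → C) {ι : Type} [Fintype ι] (a b : ι → C)
    (hab : K.comul x = ∑ i, P.tmulM (Algebra.lsmul k k C) (Algebra.lsmul k k C) (a i) (b i)) :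
    P.coface K n (n + 1) (P.cochainMk n (Fin.cons x c)) =
      ∑ i, P.cochainMk (n + 1) (Fin.snoc (Fin.cons (b i) c) (a i)) := by
  rw [coface, CocyclicModule.conjCoface_last (P.cofaceZero K) P.rotateEquiv_pow n,
    P.cofaceZero_cons K n x c a b hab, map_sum]
  exact Finset.sum_congr rfl fun i _ => P.rotate_cons _ _ _

/-- Rotation moves any adjacent pair to the front, where `cochainMk_balance` applies; no induction
over the nested tensor power is needed. -/
theorem cochainMk_update_balance (n : ℕ) (r : R) (i : Fin (n + 1)) (c : Fin (n + 2) → C) :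
    P.cochainMk (n + 1) (Function.update c i.castSucc (P.β (op r) • c i.castSucc)) =
      P.cochainMk (n + 1) (Function.update c i.succ (P.α r • c i.succ)) := by
  induction i using Fin.induction generalizing c with
  | zero =>
    obtain ⟨x, c, rfl⟩ : ∃ x c', c = Fin.cons x c' := ⟨_, _, (Fin.cons_self_tail c).symm⟩
    obtain ⟨y, c, rfl⟩ : ∃ x c', c = Fin.cons x c' := ⟨_, _, (Fin.cons_self_tail c).symm⟩
    rw [Fin.castSucc_zero, Fin.update_cons_zero, ← Fin.cons_update, Fin.update_cons_zero]
    exact P.cochainMk_balance n r x y c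
  | succ i ih =>
    obtain ⟨x, c, rfl⟩ : ∃ x c', c = Fin.cons x c' := ⟨_, _, (Fin.cons_self_tail c).symm⟩
    refine (P.rotateEquiv (n + 1)).injective ?_
    have := ih (Fin.snoc c x)
    rw [Fin.succ_castSucc, Fin.snoc_castSucc, Fin.snoc_castSucc, ← Fin.snoc_update,
      ← Fin.snoc_update] at this
    rw [← Fin.succ_castSucc, ← Fin.cons_update, ← Fin.cons_update, rotateEquiv_apply,
      rotateEquiv_apply, rotate_cons, rotate_cons]
    exact this

/-- After removal of the contracted entry its two neighbours are adjacent, and the scalar passes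
from one to the other by balancing. -/
theorem cochainMk_contractNth_castSucc (n : ℕ) (j : Fin (n + 1)) (c : Fin (n + 3) → C) :
    P.cochainMk (n + 1) (P.contractNth K j.castSucc c) =
      P.cochainMk (n + 1) (j.castSucc.succ.removeNth (Function.update c j.succ.succ
        (P.α (K.counit (c j.castSucc.succ)) • c j.succ.succ))) := by
  have h1 : j.castSucc.succ.succAbove j.castSucc = j.castSucc.castSucc := by simp
  have h2 : j.castSucc.succ.succAbove j.succ = j.succ.succ := by
    rw [Fin.succ_succAbove_succ, Fin.succAbove_castSucc_self]
  have key := P.cochainMk_update_balance n (K.counit (c j.castSucc.succ)) j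
    (j.castSucc.succ.removeNth c)
  rw [← Fin.removeNth_update_succAbove, ← Fin.removeNth_update_succAbove, Fin.removeNth_apply,
    Fin.removeNth_apply, h1, h2] at key
  exact key

end

end ParaHopfAlgebroid

theorem theorem3p1 {k : Type v} {R : Type u} {H : Type w} [CommRing k] [Ring R] [Algebra k R]
    [Ring H] [Algebra k H] (P : ParaHopfAlgebroid k R H)
    (C : Type u) [AddCommGroup C] [Module k C] [Module H C] [IsScalarTower k H C]
    (K : ModuleCoring P.toBialgebroid C) :
    ∃! X : CocyclicModule k (P.Cochain C),
      -- the cofaces in degree zero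
      (∀ (c : C) (r : R) (ι : Type) [Fintype ι] (a b : ι → C),
        K.comul c = ∑ i, P.tmulM (Algebra.lsmul k k C) (Algebra.lsmul k k C) (a i) (b i) →
        X.δ 0 0 (P.zeroMk c r) = ∑ i, P.succMk ![a i, P.β (op r) • b i] ∧
        X.δ 0 1 (P.zeroMk c r) = ∑ i, P.succMk ![b i, P.α r • a i]) ∧
      -- the cofaces with index at most `n + 1` on the cochains of degree `n + 1`
      (∀ (n : ℕ) (c : Fin (n + 2) → C) (j : Fin (n + 2)) (ι : Type) [Fintype ι] (a b : ι → C),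
        K.comul (c j) = ∑ i, P.tmulM (Algebra.lsmul k k C) (Algebra.lsmul k k C) (a i) (b i) →
        X.δ (n + 1) j.castSucc (P.succMk c) =
          ∑ i, P.succMk (j.castSucc.insertNth (α := fun _ => C) (a i)
            (Function.update c j (b i)))) ∧
      -- the last coface
      (∀ (n : ℕ) (c : Fin (n + 2) → C) (ι : Type) [Fintype ι] (a b : ι → C),
        K.comul (c 0) = ∑ i, P.tmulM (Algebra.lsmul k k C) (Algebra.lsmul k k C) (a i) (b i) →
        X.δ (n + 1) (Fin.last (n + 2)) (P.succMk c) =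
          ∑ i, P.succMk (Fin.snoc (α := fun _ => C) (Function.update c 0 (b i)) (a i))) ∧
      -- the codegeneracy from degree one to degree zero
      (∀ c : Fin 2 → C, X.σ 0 0 (P.succMk c) = P.zeroMk (c 0) (K.counit (c 1))) ∧
      -- the other codegeneracies, where `ε(c j)` acts on the next factor or on the previous one
      (∀ (n : ℕ) (c : Fin (n + 3) → C) (j : Fin (n + 1)),
        X.σ (n + 1) j.castSucc (P.succMk c) = P.succMk (j.castSucc.succ.removeNth
          (Function.update c j.succ.succ (P.α (K.counit (c j.castSucc.succ)) • c j.succ.succ))) ∧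
        X.σ (n + 1) j.succ (P.succMk c) = P.succMk (j.succ.succ.removeNth
          (Function.update c j.succ.castSucc
            (P.β (op (K.counit (c j.succ.succ))) • c j.succ.castSucc)))) ∧
      -- the cyclic operator
      X.τ 0 = LinearMap.id ∧
      (∀ (n : ℕ) (c : Fin (n + 2) → C), X.τ (n + 1) (P.succMk c) = P.succMk fun i => c (i + 1)) := by
  refine existsUnique_of_exists_of_unique ⟨(P.generators K).toCocyclicModule, ?_⟩ ?_
  · refine ⟨fun c r ι _ a b hab => ⟨?_, ?_⟩, fun n c j ι _ a b hab => ?_,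
      fun n c ι _ a b hab => ?_, fun c => ?_, fun n c j => ⟨?_, ?_⟩, rfl, fun n c => ?_⟩
    -- The scalar is absorbed through `β` for `δ₀` and through `α` for `δ₁`, because `Δ(β(r)c)`
    -- carries it on `c⁽²⁾` and `Δ(α(r)c)` on `c⁽¹⁾`.
    · rw [P.zeroMk_eq_β]
      have := P.coface_cochainMk K 0 0 (fun _ => P.β (op r) • c) _ _ (P.comul_β_smul K r c a b hab)
      refine this.trans (Finset.sum_congr rfl fun i _ => congrArg P.succMk ?_)
      ext l
      fin_cases l <;> rfl
    · rw [P.zeroMk_eq_α]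
      have := P.coface_last_cons K 0 (P.α r • c) ![] _ _ (P.comul_α_smul K r c a b hab)
      rw [Nat.cast_zero, zero_add (1 : ℤ)] at this
      refine this.trans (Finset.sum_congr rfl fun i _ => congrArg P.succMk ?_)
      ext l
      fin_cases l <;> rfl
    · exact P.coface_cochainMk K (n + 1) j c a b hab
    · obtain ⟨x, c, rfl⟩ : ∃ x c', c = Fin.cons x c' := ⟨_, _, (Fin.cons_self_tail c).symm⟩
      simp only [Fin.update_cons_zero]
      exact P.coface_last_cons K (n + 1) x c a b hab
    · exact LinearMap.congr_fun
        (CocyclicModule.conjCodegeneracy_zero P.rotateEquiv (P.codegeneracyZero K) 0) (P.succMk c)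
    · exact (P.codegeneracy_cochainMk K (n + 1) j.castSucc c).trans
        (P.cochainMk_contractNth_castSucc K n j c)
    · exact P.codegeneracy_cochainMk K (n + 1) j.succ c
    · exact P.rotate_cochainMk (n + 1) c
  · rintro Y Z ⟨y₁, y₂, y₃, y₄, y₅, y₆, y₇⟩ ⟨z₁, z₂, z₃, z₄, z₅, z₆, z₇⟩
    refine CocyclicModule.ext_of_maps (fun n i => P.cochainMk_ext n fun c => ?_)
      (fun n j => P.cochainMk_ext (n + 1) fun c => ?_) (fun n => ?_)
    · cases n with
      | zero =>
        obtain ⟨p, a, b, hab⟩ := BalancedTensor.exists_sum _ _ (K.comul (c 0))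
        match i with
        -- The scalar is `1` because the elements `c ⊗_H 1` already span degree zero.
        | 0 => exact (y₁ _ 1 _ a b hab).1.trans (z₁ _ 1 _ a b hab).1.symm
        | 1 => exact (y₁ _ 1 _ a b hab).2.trans (z₁ _ 1 _ a b hab).2.symm
      | succ n =>
        induction i using Fin.lastCases with
        | last =>
          obtain ⟨p, a, b, hab⟩ := BalancedTensor.exists_sum _ _ (K.comul (c 0))
          exact (y₃ n c _ a b hab).trans (z₃ n c _ a b hab).symm
        | cast j =>
          obtain ⟨p, a, b, hab⟩ := BalancedTensor.exists_sum _ _ (K.comul (c j))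
          exact (y₂ n c j _ a b hab).trans (z₂ n c j _ a b hab).symm
    · cases n with
      | zero =>
        obtain rfl : j = 0 := Fin.fin_one_eq_zero j
        exact (y₄ c).trans (z₄ c).symm
      | succ n =>
        induction j using Fin.cases with
        | zero => exact (y₅ n c 0).1.trans (z₅ n c 0).1.symm
        | succ j => exact (y₅ n c j).2.trans (z₅ n c j).2.symm
    · cases n with
      | zero => exact y₆.trans z₆.symm
      | succ n => exact P.cochainMk_ext (n + 1) fun c => (y₇ n c).trans (z₇ n c).symm
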